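/- Let $\mathbb N=\{1,2,3,\dots\}$ and $\omega=\{0,1,2,\dots\}$. All matrices have rational entries, countably many rows and columns (at least one of each), and finitely many nonzero entries in each row. For a matrix $A$ and a vector $\vec x$ of positive integers, $\mathrm{Im}(A\vec x)$ is the set of entries of $A\vec x$. The matrix $A$ is *image partition regular* (IPR) if for every finite colouring of $\mathbb N$ there is a vector $\vec x$ with entries in $\mathbb N$ such that all entries of $A\vec x$ are positive integers of the same colour. $A$ *image dominates* $B$ if for every vector $\vec x$ with entries in $\mathbb N$ there is a vector $\vec y$ with entries in $\mathbb N$ such that $\mathrm{Im}(B\vec y)\subseteq\mathrm{Im}(A\vec x)$. An IPR matrix $A$ is *universally image maximal* if $A$ image dominates every IPR matrix $B$ which image dominates $A$. Let $\langle B_n\rangle_{n=0}^\infty$ be an enumeration of all finite IPR matrices, $B_n$ being a $u(n)\times v(n)$ matrix with $u(n),v(n)\ge 1$. A *DH-matrix* $\mathbf D$ is an $\omega\times\omega$ matrix whose rows are all the concatenations $\vec r_0{}^\frown\vec r_1{}^\frown\vec r_2{}^\frown\cdots$ in which each $\vec r_n$ is either a row of $B_n$ or the zero vector of length $v(n)$,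 where $\vec r_n$ is chosen to be a row of $B_n$ for at least one and only finitely many $n$. For a sequence $\langle Y_n\rangle_{n=0}^\infty$ of finite nonempty sets of rationals let $$FS(\langle Y_n\rangle)=\Big\{\sum_{t\in F}x_t: F\subseteq\omega\text{ finite nonempty},\ x_t\in Y_t\ (t\in F)\Big\},$$ $$MT(\langle 2,1\rangle,\langle Y_n\rangle)=\Big\{2\sum_{t\in F}x_t+\sum_{t\in G}x_t: F,G\subseteq\omega\text{ finite nonempty},\ \max F<\min G,\ x_t\in Y_t\ (t\in F\cup G)\Big\}.$$ Let $\beta\mathbb N$ be the set of ultrafilters on $\mathbb N$ with the operation given by $A\in p+q\iff\{x\in\mathbb N:\{y\in\mathbb N:x+y\in A\}\in q\}\in p$. A *minimal idempotent* is a $p\in\beta\mathbb N$ with $p+p=p$ which belongs to the smallest two-sided ideal of $(\beta\mathbb N,+)$. **Theorem.** (1) Let $p$ be a minimal idempotent in $\beta\mathbb N$ and let $A\in p$. There exist $b\in\mathbb N$ and a sequence $\langle Y_n\rangle_{n=0}^\infty$ of finite nonempty subsets of $\mathbb N$ such that for each $n$ there is $\vec x\in\mathbb N^{v(n)}$ with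 $Y_n=\mathrm{Im}(B_n\vec x)$, and $$FS(\langle Y_n\rangle_{n=0}^\infty)\cup\big(b+MT(\langle 2,1\rangle,\langle Y_n\rangle_{n=0}^\infty)\big)\subseteq A.$$ (2) Every DH-matrix $\mathbf D$ is IPR but is not universally image maximal. -/

import Mathlib

open scoped Pointwise

attribute [local instance] Ultrafilter.add

namespace DH

/-! ### The Stone-Čech compactification of the positive integers

`Ultrafilter ℕ+` is `βℕ`, where `ℕ = {1, 2, 3, …}`. The operation is Mathlib's `Ultrafilter.add`:
`A ∈ p + q` if and only if `{x | {y | x + y ∈ A} ∈ q} ∈ p`. -/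

/-- `I` is a (nonempty) two-sided ideal of `(βℕ, +)`. -/
def IsTwoSidedIdeal (I : Set (Ultrafilter ℕ+)) : Prop :=
  I.Nonempty ∧ ∀ p ∈ I, ∀ q : Ultrafilter ℕ+, q + p ∈ I ∧ p + q ∈ I

/-- The smallest two-sided ideal `K(βℕ)`: the intersection of all two-sided ideals. -/
def smallestIdeal : Set (Ultrafilter ℕ+) :=
  ⋂₀ {I | IsTwoSidedIdeal I}

/-- A minimal idempotent of `βℕ`: an idempotent lying in the smallest two-sided ideal. -/
def IsMinimalIdempotent (p : Ultrafilter ℕ+) : Prop :=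
  p + p = p ∧ p ∈ smallestIdeal

/-! ### Matrices, images, image partition regularity -/

/-- Each row has only finitely many nonzero entries. -/
def RowFinite {ι κ : Type} (A : Matrix ι κ ℚ) : Prop :=
  ∀ i, {j | A i j ≠ 0}.Finite

/-- The vector `A x`, for a row-finite matrix `A` and a vector `x` of positive integers. -/
noncomputable def apply {ι κ : Type} (A : Matrix ι κ ℚ) (x : κ → ℕ+) (i : ι) : ℚ :=
  ∑ᶠ j, A i j * ((x j : ℕ) : ℚ)

/-- `Im(A x)`: the set of entries of `A x`. -/
def image {ι κ : Type} (A : Matrix ι κ ℚ) (x : κ → ℕ+) : Set ℚ :=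
  Set.range (apply A x)

/-- A set of positive integers, regarded as a set of rationals. -/
def toRat (A : Set ℕ+) : Set ℚ :=
  (fun n : ℕ+ => ((n : ℕ) : ℚ)) '' A

/-- `A` is image partition regular: `A` has finitely many nonzero entries in each row, and for
every colouring of the positive integers with finitely many colours there is a vector `x` of
positive integers such that all the entries of `A x` are positive integers of one colour. -/
def IsIPR {ι κ : Type} (A : Matrix ι κ ℚ) : Prop :=
  RowFinite A ∧ ∀ (r : ℕ) (c : ℕ+ → Fin r), ∃ (x : κ → ℕ+) (k : Fin r),
    image A x ⊆ toRat {n | c n = k}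

/-- `A` image dominates `B`: every image of `A` contains an image of `B`. -/
def ImageDominates {ι κ ι' κ' : Type} (A : Matrix ι κ ℚ) (B : Matrix ι' κ' ℚ) : Prop :=
  ∀ x : κ → ℕ+, ∃ y : κ' → ℕ+, image B y ⊆ image A x

/-- `A` is universally image maximal: `A` is IPR, and `A` image dominates every IPR matrix `B`
(with countably many rows and columns) which image dominates `A`. -/
def UniversallyImageMaximal {ι κ : Type} (A : Matrix ι κ ℚ) : Prop :=
  IsIPR A ∧ ∀ (ι' κ' : Type) [Countable ι'] [Nonempty ι'] [Countable κ'] [Nonempty κ']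
    (B : Matrix ι' κ' ℚ), IsIPR B → ImageDominates B A → ImageDominates A B

/-! ### Finite IPR matrices and the DH-matrix -/

/-- The type of all finite IPR matrices with rational entries (of size `u × v` with
`u, v ≥ 1`). -/
structure FiniteIPRMatrix where
  /-- the number of rows -/
  u : ℕ
  /-- the number of columns -/
  v : ℕ
  u_pos : 0 < u
  v_pos : 0 < v
  /-- the matrix itself -/
  mat : Matrix (Fin u) (Fin v) ℚ
  isIPR : IsIPR mat

/-- The first column of the `n`-th block: `k(0) = 0` and `k(n+1) = k(n) + v(n)`. -/
def blockStart (B : ℕ → FiniteIPRMatrix) (n : ℕ) : ℕ :=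
  ∑ j ∈ Finset.range n, (B j).v

/-- The rows of the DH-matrix: all concatenations `r₀ ⌢ r₁ ⌢ r₂ ⌢ …` in which `r_n` is a row of
`B n` for `n` in a finite nonempty set `F`, and `r_n` is the zero vector with `v(n)` entries
for `n` outside `F`. -/
def dhRows (B : ℕ → FiniteIPRMatrix) : Set (ℕ → ℚ) :=
  {r | ∃ (F : Finset ℕ) (i : (n : ℕ) → Fin (B n).u), F.Nonempty ∧
    ∀ (n : ℕ) (t : Fin (B n).v),
      r (blockStart B n + t) = if n ∈ F then (B n).mat (i n) t else 0}

/-- `D` is a DH-matrix built from `B`: an `ω × ω` matrix whose rows are exactly the rows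
described in `dhRows`. -/
def IsDHMatrix (B : ℕ → FiniteIPRMatrix) (D : Matrix ℕ ℕ ℚ) : Prop :=
  Set.range (fun i => D i) = dhRows B

/-! ### Finite sums and Milliken-Taylor systems of sequences of sets -/

/-- `FS(⟨Y_n⟩)`: all sums over finite nonempty index sets `F`, with one term from each `Y_n`,
`n ∈ F`. -/
def FS (Y : ℕ → Set ℚ) : Set ℚ :=
  {z | ∃ (F : Finset ℕ) (x : ℕ → ℚ), F.Nonempty ∧ (∀ t ∈ F, x t ∈ Y t) ∧ z = ∑ t ∈ F, x t}

/-- `MT(⟨a_0, …, a_k⟩, ⟨Y_n⟩)`: all `∑ i, a_i ∑ t ∈ F_i, x_t` with `F_0 < F_1 < ⋯ < F_k` finite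
nonempty and `x_t ∈ Y_t` for each `t` in the union of the `F_i`. -/
def MT {k : ℕ} (a : Fin (k + 1) → ℤ) (Y : ℕ → Set ℚ) : Set ℚ :=
  {z | ∃ (F : Fin (k + 1) → Finset ℕ) (x : ℕ → ℚ),
    (∀ i, (F i).Nonempty) ∧
    (∀ i j, i < j → ∀ s ∈ F i, ∀ t ∈ F j, s < t) ∧
    (∀ i, ∀ t ∈ F i, x t ∈ Y t) ∧
    z = ∑ i, (a i : ℚ) * ∑ t ∈ F i, x t}

end DH

namespace DH

attribute [local instance] Ultrafilter.addSemigroup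

open Filter

/-! ### Minimal idempotents -/

/-! Part (1). Write `2p` for the image of `p` under doubling. Because `p` lies in the smallest
ideal, `p = s + (2p + p)` for some `s`, so a member `A` of `p` has a translate by some `b` belonging
to `2p + p`: for `p`-many `x`, `b + 2x + y ∈ A` for `p`-many `y`. A Galvin-style recursion along the
idempotent `p` (`exists_seq_of_idempotent`) then picks the sets `Yₙ` one at a time, provided every
member of `p` contains an image of every finite IPR matrix.

That fact is `IsIPR.exists_image_subset_of_mem`. Colouring by leading digits and passing to a limit
inside a closed rational cone puts the rows, after a nonnegative change of variables, into
first-entries form with a common leading coefficient (`IsIPR.exists_staircase`). The new variables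
are then chosen one at a time as ultrafilters; minimality of `p` allows a single new variable to
send all the relevant rows to `p` simultaneously (`exists_lift_minimalIdempotent`).

Part (2). `extend B D` adjoins to `D` a column carrying `b` and rows producing `b + MT(⟨2, 1⟩,
⟨Yₙ⟩)`. It dominates `D` by forgetting `b`, and it is IPR by part (1), so `D` is IPR too. Conversely
`D` has an image so sparse in binary that sums can be decoded block by block, and in which no block
contains both a number and its double (`exists_isSparse`). Decoding `b + 2x + y` there would exhibit
such a double, so `D` does not dominate `extend B D`. -/

theorem map_add_ultrafilter {M N : Type*} [Add M] [Add N] (f : M → N)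
    (hf : ∀ x y, f (x + y) = f x + f y) (p q : Ultrafilter M) :
    (p + q).map f = p.map f + q.map f := by
  apply Ultrafilter.coe_inj.mp
  apply Filter.ext'
  intro P
  rw [Ultrafilter.eventually_add]
  simp only [Ultrafilter.coe_map, eventually_map]
  rw [Ultrafilter.eventually_add]
  simp only [hf]

/-- A minimal closed left ideal. -/
theorem exists_minimal_closed_leftIdeal (M : Type*) [AddSemigroup M] [Nonempty M] :
    ∃ L : Set (Ultrafilter M), IsClosed L ∧ L.Nonempty ∧ (∀ q ∈ L, ∀ s, s + q ∈ L) ∧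
      ∀ q ∈ L, ∀ r ∈ L, ∃ t, t + q = r := by
  let S : Set (Set (Ultrafilter M)) :=
    {N | IsClosed N ∧ N.Nonempty ∧ ∀ q ∈ N, ∀ s, s + q ∈ N}
  rsuffices ⟨L, hL⟩ : ∃ L, Minimal (· ∈ S) L
  · obtain ⟨hc, hne, hid⟩ := hL.prop
    refine ⟨L, hc, hne, hid, fun q hq r hr => ?_⟩
    -- The translate of the whole semigroup by `q` is a closed left ideal inside `L`, so minimality
    -- gives equality.
    have : Set.range (· + q) = L := by
      apply hL.eq_of_subset
      · refine ⟨(isCompact_range (Ultrafilter.continuous_add_left q)).isClosed,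
          ⟨_, ⟨q, rfl⟩⟩, ?_⟩
        rintro _ ⟨t, rfl⟩ s
        exact ⟨s + t, add_assoc _ _ _⟩
      · rintro _ ⟨t, rfl⟩
        exact hid q hq t
    rw [← this] at hr
    exact hr
  refine zorn_superset _ fun c hcs hc => ?_
  refine ⟨⋂₀ c, ⟨isClosed_sInter fun t ht => (hcs ht).1, ?_, fun m hm s => ?_⟩, fun s hs =>
      Set.sInter_subset_of_mem hs⟩
  · obtain rfl | hcnemp := c.eq_empty_or_nonempty
    · rw [Set.sInter_empty]
      apply Set.univ_nonempty
    · rw [Set.sInter_eq_iInter]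
      have := hcnemp.coe_sort
      refine IsCompact.nonempty_iInter_of_directed_nonempty_isCompact_isClosed
        ((↑) : c → Set (Ultrafilter M)) ?_ ?_ ?_ ?_
      · exact DirectedOn.directed_val (IsChain.directedOn hc.symm)
      exacts [fun i => (hcs i.prop).2.1, fun i => (hcs i.prop).1.isCompact,
        fun i => (hcs i.prop).1]
  · rw [Set.mem_sInter]
    exact fun t ht => (hcs ht).2.2 m (Set.mem_sInter.mp hm t ht) s

/-- The elements with this recovery property form a two-sided ideal, nonempty because it contains
every element of a minimal closed left ideal; hence it contains the smallest ideal. -/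
theorem exists_eq_add_add_of_mem_smallestIdeal {p : Ultrafilter ℕ+} (hp : p ∈ smallestIdeal)
    (f : Ultrafilter ℕ+) : ∃ t, t + (f + p) = p := by
  refine hp {q | ∀ f, ∃ t, t + (f + q) = q} ⟨?_, ?_⟩ f
  · obtain ⟨L, -, ⟨q, hq⟩, hid, hmin⟩ := exists_minimal_closed_leftIdeal ℕ+
    exact ⟨q, fun f => hmin _ (hid q hq f) _ hq⟩
  · intro q hq s
    refine ⟨fun f => ?_, fun f => ?_⟩
    · obtain ⟨t, ht⟩ := hq (f + s)
      refine ⟨s + t, ?_⟩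
      conv_rhs => rw [← ht]
      simp only [add_assoc]
    · obtain ⟨t, ht⟩ := hq f
      refine ⟨t, ?_⟩
      conv_rhs => rw [← ht]
      simp only [add_assoc]

/-- A minimal closed left ideal is a compact semigroup, so it has an idempotent `p`. For `j` in any
two-sided ideal, `j + p` stays in the left ideal and a further left translate recovers `p`. -/
theorem exists_isMinimalIdempotent : ∃ p : Ultrafilter ℕ+, IsMinimalIdempotent p := by
  obtain ⟨L, hc, hne, hid, hmin⟩ := exists_minimal_closed_leftIdeal ℕ+
  obtain ⟨p, hpL, hp⟩ := exists_idempotent_in_compact_add_subsemigroup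
    Ultrafilter.continuous_add_left L hne hc.isCompact fun x _ y hy => hid y hy x
  refine ⟨p, hp, ?_⟩
  rintro J ⟨⟨j, hj⟩, hJ⟩
  obtain ⟨t, ht⟩ := hmin (j + p) (hid p hpL j) p hpL
  rw [← ht]
  exact (hJ _ (hJ j hj p).2 t).1

/-- A minimal idempotent is minimal for the order `f ≤ p ↔ f + p = p + f = f`. -/
theorem IsMinimalIdempotent.add_eq {p f : Ultrafilter ℕ+} (hp : IsMinimalIdempotent p)
    (hf : f + f = f) (hfp : f + p = f) : p + f = p := by
  obtain ⟨t, ht⟩ := exists_eq_add_add_of_mem_smallestIdeal hp.2 f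
  rw [hfp] at ht
  rw [← ht, add_assoc, hf]

/-- Reduction mod `d` sends `p` to an idempotent of a finite group, that is, to `0`. -/
theorem dvd_mem_of_idempotent {p : Ultrafilter ℕ+} (hp : p + p = p) (d : ℕ) (hd : 0 < d) :
    {x : ℕ+ | d ∣ (x : ℕ)} ∈ p := by
  have : NeZero d := ⟨hd.ne'⟩
  obtain ⟨a, ha⟩ : ∃ a : ZMod d, p.map (fun x : ℕ+ => ((x : ℕ) : ZMod d)) = pure a :=
    (Ultrafilter.eq_pure_of_finite _)
  have h2 : (pure a : Ultrafilter (ZMod d)) + pure a = pure a := by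
    rw [← ha, ← map_add_ultrafilter _ (by intro x y; push_cast; rfl), hp]
  have h3 : ∀ᶠ x in ((pure a : Ultrafilter (ZMod d)) + pure a : Ultrafilter _), x = a := by
    rw [h2]; exact Filter.eventually_pure.2 rfl
  rw [Ultrafilter.eventually_add] at h3
  have h4 : a + a = a := by simpa using h3
  have h5 : a = 0 := by simpa using h4
  have h6 : {x | x = 0} ∈ p.map (fun x : ℕ+ => ((x : ℕ) : ZMod d)) := by
    rw [ha, h5]; exact rfl
  rw [Ultrafilter.mem_map] at h6
  filter_upwards [h6] with x hx
  exact (ZMod.natCast_eq_zero_iff _ _).1 hx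

/-! ### Lifting a minimal idempotent along several homomorphisms -/

theorem ultrafilter_eq_of_le {α : Type*} {p q : Ultrafilter α} (h : ∀ s ∈ q, s ∈ p) : p = q :=
  Ultrafilter.coe_le_coe.1 h

theorem isClosed_setOf_map_eq {α β : Type*} (f : α → β) (w : Ultrafilter β) :
    IsClosed {i : Ultrafilter α | i.map f = w} := by
  have : {i : Ultrafilter α | i.map f = w} = ⋂ s ∈ w, {i : Ultrafilter α | f ⁻¹' s ∈ i} := by
    ext i
    simp only [Set.mem_ofPred_eq, Set.mem_iInter]
    constructor
    · rintro rfl s hs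
      exact hs
    · intro h
      exact ultrafilter_eq_of_le fun s hs => h s hs
  rw [this]
  exact isClosed_biInter fun s _ => ultrafilter_isClosed_basic _

/-- Extending an ultrafilter by one more variable so that finitely or infinitely many
homomorphisms simultaneously push it forward to a given minimal idempotent. -/
theorem exists_lift_minimalIdempotent {V ι : Type*} [AddCommMonoid V] {p : Ultrafilter ℕ+}
    (hp : IsMinimalIdempotent p) {w : Ultrafilter V} (hw : w + w = w)
    (φ : ι → ℕ+ × V → ℕ+) (hφ : ∀ r x y, φ r (x + y) = φ r x + φ r y)
    (q : Ultrafilter ℕ+) (hq : ∀ r, q.map (fun y => φ r (y, 0)) = p) :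
    ∃ G : Ultrafilter (ℕ+ × V), G.map Prod.snd = w ∧ ∀ r, G.map (φ r) = p := by
  have hsnd : ∀ a b : Ultrafilter (ℕ+ × V),
      (a + b).map Prod.snd = a.map Prod.snd + b.map Prod.snd :=
    map_add_ultrafilter _ fun _ _ => rfl
  set e : Ultrafilter (ℕ+ × V) := q.map (fun y => (y, 0)) with he
  have hes : ∀ t ∈ e.map Prod.snd, (0 : V) ∈ t := by
    intro t ht
    rw [he, Ultrafilter.map_map, Ultrafilter.mem_map] at ht
    obtain ⟨y, hy⟩ := Ultrafilter.nonempty_of_mem ht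
    exact hy
  have hes0 : e.map Prod.snd = (pure 0 : Ultrafilter V) :=
    (ultrafilter_eq_of_le (p := pure 0) (q := e.map Prod.snd) hes).symm
  have h0w : (pure 0 : Ultrafilter V) + w = w := by
    apply ultrafilter_eq_of_le
    intro s hs
    change ∀ᶠ x in ((pure 0 : Ultrafilter V) + w : Ultrafilter V), x ∈ s
    rw [Ultrafilter.eventually_add]
    refine Filter.eventually_pure.2 ?_
    simpa using hs
  have hw0 : w + (pure 0 : Ultrafilter V) = w := by
    apply ultrafilter_eq_of_le
    intro s hs
    change ∀ᶠ x in (w + (pure 0 : Ultrafilter V) : Ultrafilter V), x ∈ s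
    rw [Ultrafilter.eventually_add]
    filter_upwards [hs] with x hx
    refine Filter.eventually_pure.2 ?_
    simpa using hx
  have hep : ∀ r, e.map (φ r) = p := fun r => by rw [← hq r, he, Ultrafilter.map_map]; rfl
  let I : Set (Ultrafilter (ℕ+ × V)) := {i | i.map Prod.snd = w}
  have hI : IsCompact I := (isClosed_setOf_map_eq _ _).isCompact
  have hIne : I.Nonempty := by
    refine ⟨w.map (fun x => (1, x)), ?_⟩
    simp only [I, Set.mem_ofPred_eq, Ultrafilter.map_map]
    exact Ultrafilter.map_id w
  -- `I + e` is closed under addition since `e` lies over `0` and `w` is idempotent.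
  obtain ⟨f, ⟨i, hi, hif⟩, hff⟩ := exists_idempotent_in_compact_add_subsemigroup
    Ultrafilter.continuous_add_left ((· + e) '' I) (hIne.image _)
    (hI.image (Ultrafilter.continuous_add_left e)) (by
      rintro _ ⟨a, ha, rfl⟩ _ ⟨b, hb, rfl⟩
      refine ⟨a + e + b, ?_, add_assoc _ _ _⟩
      change Ultrafilter.map Prod.snd a = w at ha
      change Ultrafilter.map Prod.snd b = w at hb
      change Ultrafilter.map Prod.snd _ = w
      rw [hsnd, hsnd, ha, hb, hes0, hw0, hw])
  change i + e = f at hif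
  change Ultrafilter.map Prod.snd i = w at hi
  -- Each `φ r` sends `f = i + e` to an idempotent `f'` with `f' + p = f'`; minimality gives `p + f'
  -- = p`, which is the image of `e + f`.
  refine ⟨e + f, ?_, fun r => ?_⟩
  · rw [← hif, hsnd, hsnd, hi, hes0, hw0, h0w]
  · rw [map_add_ultrafilter _ (hφ r), hep]
    refine hp.add_eq ?_ ?_
    · rw [← map_add_ultrafilter _ (hφ r), hff]
    · rw [← hif, map_add_ultrafilter _ (hφ r), hep, add_assoc, hp.1]

theorem exists_ultrafilter_map_mul_eq {p : Ultrafilter ℕ+} (hp : p + p = p) (c : ℕ+) :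
    ∃ q : Ultrafilter ℕ+, q.map (fun y => c * y) = p := by
  have hdiv : Set.range (fun y : ℕ+ => c * y) ∈ p := by
    filter_upwards [dvd_mem_of_idempotent hp c c.pos] with x hx
    obtain ⟨y, hy⟩ := PNat.dvd_iff.2 hx
    exact ⟨y, hy.symm⟩
  exact ⟨p.comap (mul_right_injective c) hdiv, Ultrafilter.coe_inj.1
    (by simpa using Filter.map_comap_of_mem hdiv)⟩

/-- Homomorphisms arranged as a staircase with respect to vectors `X j`: all of them
can be made to push forward one ultrafilter to a given minimal idempotent. -/
theorem exists_ultrafilter_of_staircase {V ι : Type*} [AddCommMonoid V] {p : Ultrafilter ℕ+}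
    (hp : IsMinimalIdempotent p) {P : Set V} (hPne : P.Nonempty)
    (hP : ∀ x ∈ P, ∀ y, x + y ∈ P) (h : ι → V →+ ℤ) (g : ι → ℕ) (X : ℕ → V) (c : ℕ+)
    (h1 : ∀ r, h r (X (g r)) = (c : ℕ)) (h0 : ∀ r j, j < g r → h r (X j) = 0)
    (σ : V →+ ℕ) (hσ : ∀ r x, 0 ≤ σ x + h r x) (k : ℕ) (hk : ∀ r, g r < k) (j : ℕ)
    (hj : j ≤ k) :
    ∃ W : Ultrafilter V, P ∈ W ∧
      ∀ r, j ≤ g r → W.map (h r) = p.map (fun n : ℕ+ => ((n : ℕ) : ℤ)) := by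
  induction hj using Nat.decreasingInduction with
  | self =>
    obtain ⟨x, hx⟩ := hPne
    exact ⟨pure x, hx, fun r hr => absurd (hk r) hr.not_gt⟩
  | of_succ j hj ih =>
    set pz := p.map (fun n : ℕ+ => ((n : ℕ) : ℤ)) with hpz
    have hpzz : pz + pz = pz := by
      rw [hpz, ← map_add_ultrafilter _ (by intro x y; push_cast; rfl), hp.1]
    -- The ultrafilters that already work for levels above `j` form a compact semigroup, so the one
    -- to be extended may be taken idempotent.
    obtain ⟨w, ⟨hwP, hwh⟩, hw⟩ := exists_idempotent_in_compact_add_subsemigroup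
      Ultrafilter.continuous_add_left
      {W : Ultrafilter V | P ∈ W ∧ ∀ r, j + 1 ≤ g r → W.map (h r) = pz} ih
      (by
        have : {W : Ultrafilter V | P ∈ W ∧ ∀ r, j + 1 ≤ g r → W.map (h r) = pz} =
            {W | P ∈ W} ∩ ⋂ (r) (_ : j + 1 ≤ g r), {W : Ultrafilter V | W.map (h r) = pz} := by
          ext W; simp
        rw [this]
        exact ((ultrafilter_isClosed_basic _).inter
          (isClosed_iInter fun r => isClosed_iInter fun _ =>
            isClosed_setOf_map_eq _ _)).isCompact)
      (by
        rintro W ⟨hW, hWh⟩ W' ⟨hW', hWh'⟩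
        refine ⟨?_, fun r hr => ?_⟩
        · change ∀ᶠ x in (W + W' : Ultrafilter V), x ∈ P
          rw [Ultrafilter.eventually_add]
          filter_upwards [hW] with x hx
          exact Filter.Eventually.of_forall fun y => hP x hx y
        · rw [map_add_ultrafilter _ (map_add (h r)), hWh r hr, hWh' r hr, hpzz])
    -- The shift by `σ` keeps the value positive whatever the sign of `h r`, so that `φ r` takes
    -- values in `ℕ+`.
    have hex : ∀ (r : ι) (z : ℕ+ × V), ∃ n : ℕ+,
        ((n : ℕ) : ℤ) = c * ((z.1 : ℕ) + σ z.2) + h r z.2 := by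
      intro r z
      have hc1 : (1 : ℤ) ≤ c := by exact_mod_cast c.pos
      have hz1 : (1 : ℤ) ≤ ((z.1 : ℕ) : ℤ) := by exact_mod_cast z.1.pos
      have hs : (0 : ℤ) ≤ σ z.2 := by positivity
      have hpos : 0 < (c : ℤ) * ((z.1 : ℕ) + σ z.2) + h r z.2 := by
        have := hσ r z.2
        nlinarith
      refine ⟨⟨((c : ℤ) * ((z.1 : ℕ) + σ z.2) + h r z.2).toNat, by omega⟩, ?_⟩
      simp only [PNat.mk_coe]
      omega
    choose φ hφ using hex
    obtain ⟨q, hq⟩ := exists_ultrafilter_map_mul_eq hp.1 c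
    obtain ⟨G, hG, hGp⟩ := exists_lift_minimalIdempotent hp hw φ
      (by
        intro r x y
        have : (((φ r (x + y) : ℕ+) : ℕ) : ℤ) = ((φ r x + φ r y : ℕ+) : ℕ) := by
          rw [hφ, PNat.add_coe, Nat.cast_add, hφ, hφ]
          simp only [Prod.fst_add, Prod.snd_add, map_add, PNat.add_coe]
          push_cast
          ring
        exact_mod_cast this) q
      (by
        intro r
        rw [← hq]
        congr 1
        funext y
        have : (((φ r (y, 0) : ℕ+) : ℕ) : ℤ) = ((c * y : ℕ+) : ℕ) := by
          rw [hφ]; simp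
        exact_mod_cast this)
    -- Adding a multiple of `X j` turns `h r` into `φ r` on level `j` and leaves it unchanged on
    -- higher levels.
    refine ⟨G.map (fun z => z.2 + ((z.1 : ℕ) + σ z.2) • X j), ?_, fun r hr => ?_⟩
    · rw [← hG] at hwP
      rw [Ultrafilter.mem_map] at hwP ⊢
      filter_upwards [hwP] with z hz
      exact hP _ hz _
    · rw [Ultrafilter.map_map]
      rcases hr.eq_or_lt with hr | hr
      · rw [hpz, ← hGp r, Ultrafilter.map_map]
        congr 1
        funext z
        simp only [Function.comp, hφ, map_add, map_nsmul]
        rw [hr, h1]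
        simp
        ring
      · rw [← hwh r hr, ← hG, Ultrafilter.map_map]
        congr 1
        funext z
        simp [h0 r j hr]

/-! ### Finitely generated rational cones -/

/-- Carathéodory's theorem for cones. -/
theorem exists_linearIndepOn_support {κ E : Type*} [Fintype κ] [AddCommGroup E] [Module ℚ E]
    (M : κ → E) (x : κ → ℚ) (hx : ∀ j, 0 ≤ x j) :
    ∃ y : κ → ℚ, (∀ j, 0 ≤ y j) ∧ ∑ j, y j • M j = ∑ j, x j • M j ∧
      LinearIndepOn ℚ M {j | y j ≠ 0} := by
  classical
  induction hn : (Finset.univ.filter fun j => x j ≠ 0).card using Nat.strong_induction_on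
    generalizing x with
  | _ n ih =>
    by_cases hli : LinearIndepOn ℚ M {j | x j ≠ 0}
    · exact ⟨x, hx, rfl, hli⟩
    have : ∃ l : κ → ℚ, (∀ j, x j = 0 → l j = 0) ∧ ∑ j, l j • M j = 0 ∧ ∃ j, 0 < l j := by
      have hset : {j | x j ≠ 0} = ((Finset.univ.filter fun j => x j ≠ 0 : Finset κ) : Set κ) := by
        ext; simp
      rw [hset, linearIndepOn_finset_iff] at hli
      push Not at hli
      obtain ⟨f, hf, i, hi, hfi⟩ := hli
      have hi' : x i ≠ 0 := by simpa using hi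
      have hsum : ∑ j, (if x j ≠ 0 then f j else 0) • M j = 0 := by
        rw [← hf, Finset.sum_filter]
        exact Finset.sum_congr rfl fun j _ => by split_ifs <;> simp
      rcases lt_or_gt_of_ne hfi with hneg | hpos
      · refine ⟨fun j => -(if x j ≠ 0 then f j else 0), ?_, ?_, i, ?_⟩
        · intro j hj; simp [hj]
        · simp only [neg_smul, Finset.sum_neg_distrib, hsum, neg_zero]
        · simp [hi', hneg]
      · refine ⟨fun j => if x j ≠ 0 then f j else 0, ?_, hsum, i, ?_⟩
        · intro j hj; simp [hj]
        · simp [hi', hpos]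
    obtain ⟨l, hl0, hlM, i, hi⟩ := this
    -- The minimal ratio `x m / l m` is the largest multiple of the relation `l` that can be
    -- subtracted while staying nonnegative; it kills coordinate `m`.
    obtain ⟨m, hm, hmin⟩ := Finset.exists_min_image
      (Finset.univ.filter fun j => 0 < l j) (fun j => x j / l j) ⟨i, by simpa using hi⟩
    simp only [Finset.mem_filter, Finset.mem_univ, true_and] at hm hmin
    have hxm : 0 < x m := lt_of_le_of_ne (hx m) fun h => hm.ne' (hl0 m h.symm)
    have hθ : 0 < x m / l m := div_pos hxm hm
    obtain ⟨y, hy, hys, hyl⟩ := ih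
      (Finset.univ.filter fun j => x j - x m / l m * l j ≠ 0).card (by
        rw [← hn]
        apply Finset.card_lt_card
        rw [Finset.ssubset_iff_of_subset]
        · refine ⟨m, by simp [hxm.ne'], ?_⟩
          simp [div_mul_cancel₀ _ hm.ne']
        · intro j
          simp only [Finset.mem_filter, Finset.mem_univ, true_and]
          intro h h'
          exact h (by simp [h', hl0 j h']))
      (fun j => x j - x m / l m * l j) (by
        intro j
        rcases le_or_gt (l j) 0 with h | h
        · have := mul_nonpos_of_nonneg_of_nonpos hθ.le h
          have := hx j
          linarith
        · have := (le_div_iff₀ h).1 (hmin j h)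
          linarith) rfl
    refine ⟨y, hy, ?_, hyl⟩
    rw [hys]
    simp only [sub_smul, mul_smul, Finset.sum_sub_distrib, ← Finset.smul_sum, hlM, smul_zero,
      sub_zero]

/-- By Carathéodory the cone is a finite union of cones on independent families. On each of these a
linear left inverse `P` of the parametrisation `L` turns membership into the closed conditions `P b
≥ 0` and `L (P b) = b`. This keeps the limiting argument over `ℚ`. -/
theorem isClosed_cone {κ ρ : Type*} [Fintype κ] [Fintype ρ] (M : κ → ρ → ℚ) :
    IsClosed {b : ρ → ℚ | ∃ x : κ → ℚ, (∀ j, 0 ≤ x j) ∧ ∑ j, x j • M j = b} := by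
  classical
  have key : {b : ρ → ℚ | ∃ x : κ → ℚ, (∀ j, 0 ≤ x j) ∧ ∑ j, x j • M j = b} =
      ⋃ (T : Finset κ) (_ : LinearIndepOn ℚ M (T : Set κ)),
        {b | ∃ x : T → ℚ, (∀ j, 0 ≤ x j) ∧ ∑ j, x j • M j = b} := by
    ext b
    simp only [Set.mem_ofPred_eq, Set.mem_iUnion]
    constructor
    · rintro ⟨x, hx, rfl⟩
      obtain ⟨y, hy, hys, hyl⟩ := exists_linearIndepOn_support M x hx
      have hset : {j | y j ≠ 0} = ((Finset.univ.filter fun j => y j ≠ 0 : Finset κ) : Set κ) := by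
        ext; simp
      rw [hset] at hyl
      refine ⟨_, hyl, fun j => y j, fun j => hy _, ?_⟩
      rw [← hys, Finset.sum_coe_sort _ fun j => y j • M j, Finset.sum_filter]
      refine Finset.sum_congr rfl fun j _ => ?_
      split_ifs with h
      · rfl
      · simp [not_not.1 h]
    · rintro ⟨T, -, x, hx, rfl⟩
      refine ⟨fun j => if h : j ∈ T then x ⟨j, h⟩ else 0, fun j => ?_, ?_⟩
      · beta_reduce
        split_ifs
        exacts [hx _, le_rfl]
      · rw [← Finset.sum_subset (Finset.subset_univ T), ← Finset.sum_coe_sort]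
        · exact Finset.sum_congr rfl fun j _ => by simp
        · intro j _ hj
          simp [hj]
  rw [key]
  refine isClosed_iUnion_of_finite fun T => isClosed_iUnion_of_finite fun hT => ?_
  let L : (T → ℚ) →ₗ[ℚ] (ρ → ℚ) := Fintype.linearCombination ℚ (fun j : T => M j)
  have hL : LinearMap.ker L = ⊥ := by
    rw [LinearMap.ker_eq_bot]
    exact (linearIndependent_iff_injective_fintypeLinearCombination).1 hT
  obtain ⟨P, hP⟩ := LinearMap.exists_leftInverse_of_injective L hL
  have hPL : ∀ x, P (L x) = x := fun x => LinearMap.congr_fun hP x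
  have : {b | ∃ x : T → ℚ, (∀ j, 0 ≤ x j) ∧ ∑ j, x j • M j = b} =
      {b | (∀ j, 0 ≤ P b j) ∧ L (P b) = b} := by
    ext b
    constructor
    · rintro ⟨x, hx, rfl⟩
      change (∀ j, 0 ≤ P (L x) j) ∧ L (P (L x)) = L x
      rw [hPL]
      exact ⟨hx, rfl⟩
    · rintro ⟨h, h'⟩
      exact ⟨P b, h, h'⟩
  rw [this]
  have hPc : Continuous P := LinearMap.continuous_on_pi P
  have hLc : Continuous L := LinearMap.continuous_on_pi L
  have hP0 : IsClosed {b | ∀ j, 0 ≤ P b j} := by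
    have : {b | ∀ j, 0 ≤ P b j} = ⋂ j, {b | 0 ≤ P b j} := by ext; simp
    rw [this]
    exact isClosed_iInter fun j => isClosed_le continuous_const ((continuous_apply j).comp hPc)
  exact hP0.inter (isClosed_eq (hLc.comp hPc) continuous_id)

/-! ### Finite image partition regular matrices -/

theorem apply_eq_sum {ι κ : Type} [Fintype κ] (A : Matrix ι κ ℚ) (x : κ → ℕ+) (i : ι) :
    apply A x i = ∑ j, A i j * ((x j : ℕ) : ℚ) :=
  finsum_eq_sum_of_fintype _

/-- Colouring by the position of the leading digit. -/
theorem exists_leading_digit_coloring (N : ℕ) (hN : 0 < N) :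
    ∃ (l : ℕ+ → ℕ) (r : ℕ) (c : ℕ+ → Fin r),
      (∀ m n, l m = l n → (m : ℚ) ≤ (1 + 1 / N) * n) ∧
      (∀ m n, c m = c n → l n < l m → (N : ℚ) * n ≤ m) := by
  have hN' : (0 : ℚ) < N := by exact_mod_cast hN
  have hα : (1 : ℚ) < 1 + 1 / N := by
    have : (0 : ℚ) < 1 / N := by positivity
    linarith
  set α : ℚ := 1 + 1 / N
  have hα0 : 0 < α := by linarith
  have hex : ∀ m : ℕ+, ∃ n : ℕ, α ^ n ≤ (m : ℚ) ∧ (m : ℚ) < α ^ (n + 1) := fun m =>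
    exists_nat_pow_near (by exact_mod_cast m.pos) hα
  choose l hl hl' using hex
  -- Colouring exponents mod `K + 1` forces distinct exponents of one colour to differ by at least
  -- `K + 1`; one factor `α` is lost to rounding and `α ^ K` exceeds `N`.
  obtain ⟨K, hK⟩ := pow_unbounded_of_one_lt (N : ℚ) hα
  refine ⟨l, K + 1, fun m => ⟨l m % (K + 1), Nat.mod_lt _ (by omega)⟩, ?_, ?_⟩
  · intro m n h
    calc (m : ℚ) ≤ α ^ (l m + 1) := (hl' m).le
      _ = α * α ^ l n := by rw [h]; ring
      _ ≤ α * n := by gcongr; exact hl n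
  · intro m n h hlt
    have hmod : l n ≡ l m [MOD (K + 1)] := (Fin.mk.inj_iff.1 h).symm
    have hle : l n + (K + 1) ≤ l m := by
      have h1 := (Nat.modEq_iff_dvd' hlt.le).1 hmod
      have h2 := Nat.le_of_dvd (by omega) h1
      omega
    calc (N : ℚ) * n ≤ α ^ K * α ^ (l n + 1) := by
          gcongr
          exact (hl' n).le
      _ = α ^ (l n + (K + 1)) := by ring
      _ ≤ α ^ l m := pow_le_pow_right₀ hα.le hle
      _ ≤ m := hl m

/-- A monochromatic image for the leading-digit colouring. The level `g r` counts the rows of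
strictly larger magnitude, so level `0` holds the largest entries and the possible levels do not
depend on `N`. -/
theorem IsIPR.exists_approx {u v : ℕ} {B : Matrix (Fin u) (Fin v) ℚ} (hB : IsIPR B) (N : ℕ)
    (hN : 0 < N) : ∃ (x : Fin v → ℚ) (g : Fin u → Fin (u + 1)), (∀ t, 0 ≤ x t) ∧
      (∀ r, 0 < ∑ t, B r t * x t) ∧
      (∀ r s, g r = g s → ∑ t, B r t * x t ≤ (1 + 1 / N) * ∑ t, B s t * x t) ∧
      (∀ r s, g r < g s → N * ∑ t, B s t * x t ≤ ∑ t, B r t * x t) := by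
  obtain ⟨l, k, c, hl, hc⟩ := exists_leading_digit_coloring N hN
  obtain ⟨x, i, hx⟩ := hB.2 k c
  have hy : ∀ r, ∃ n : ℕ+, c n = i ∧ ((n : ℕ) : ℚ) = ∑ t, B r t * ((x t : ℕ) : ℚ) := by
    intro r
    obtain ⟨n, hn, hn'⟩ := hx ⟨r, rfl⟩
    refine ⟨n, hn, ?_⟩
    rw [← apply_eq_sum]
    exact hn'
  choose y hyc hy using hy
  have hlt : ∀ r s, (Finset.univ.filter fun q => l (y r) < l (y q)).card <
      (Finset.univ.filter fun q => l (y s) < l (y q)).card ↔ l (y s) < l (y r) := by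
    have : ∀ r s, l (y s) ≤ l (y r) → (Finset.univ.filter fun q => l (y r) < l (y q)).card ≤
      (Finset.univ.filter fun q => l (y s) < l (y q)).card := by
      intro r s h
      refine Finset.card_le_card fun q => ?_
      simp only [Finset.mem_filter, Finset.mem_univ, true_and]
      exact h.trans_lt
    intro r s
    constructor
    · intro h
      by_contra h'
      exact (this s r (not_lt.1 h')).not_gt h
    · intro h
      apply Finset.card_lt_card
      rw [Finset.ssubset_iff_of_subset]
      · exact ⟨r, by simpa using h, by simp⟩
      · intro q
        simp only [Finset.mem_filter, Finset.mem_univ, true_and]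
        exact h.trans
  refine ⟨fun t => ((x t : ℕ) : ℚ), fun r =>
    ⟨(Finset.univ.filter fun q => l (y r) < l (y q)).card, ?_⟩, fun t => by positivity,
    fun r => ?_, fun r s hrs => ?_, fun r s hrs => ?_⟩
  · exact Nat.lt_succ_of_le ((Finset.card_le_univ _).trans (by simp))
  · rw [← hy]
    exact_mod_cast (y r).pos
  · rw [← hy, ← hy]
    refine hl _ _ ?_
    have h := Fin.mk.inj_iff.1 hrs
    have h1 := mt (hlt r s).2 h.not_lt
    have h2 := mt (hlt s r).2 h.not_gt
    omega
  · rw [← hy, ← hy]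
    refine hc _ _ ((hyc r).trans (hyc s).symm) ((hlt r s).1 ?_)
    exact hrs

/-- The rows of a finite image partition regular matrix form a staircase with respect to suitable
nonnegative rational vectors. -/
theorem IsIPR.exists_staircase {u v : ℕ} {B : Matrix (Fin u) (Fin v) ℚ} (hB : IsIPR B) :
    ∃ (g : Fin u → Fin (u + 1)) (X : Fin (u + 1) → Fin v → ℚ), (∀ j t, 0 ≤ X j t) ∧
      ∀ j r, j ≤ g r → ∑ t, B r t * X j t = if g r = j then 1 else 0 := by
  choose x g hx hpos heq hlt using fun N : ℕ => hB.exists_approx (N + 1) N.succ_pos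
  -- There are finitely many level functions, so one of them serves for arbitrarily large `N`.
  obtain ⟨g₀, hg₀⟩ := Finite.exists_infinite_fiber g
  rw [Set.infinite_coe_iff] at hg₀
  refine ⟨g₀, ?_⟩
  have : ∀ j, ∃ z : Fin v → ℚ, (∀ t, 0 ≤ z t) ∧
      ∀ r, j ≤ g₀ r → ∑ t, B r t * z t = if g₀ r = j then 1 else 0 := by
    intro j
    by_cases hj : ∃ r₀, g₀ r₀ = j
    swap
    · refine ⟨0, fun t => le_rfl, fun r _ => ?_⟩
      rw [if_neg fun h => hj ⟨r, h⟩]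
      simp
    obtain ⟨r₀, hr₀⟩ := hj
    have hcl := isClosed_cone fun (t : Fin v) (r : {r // j ≤ g₀ r}) => B r t
    -- After division by the value of a row on level `j`, rows on that level tend to `1` and rows on
    -- higher levels to `0`. Rows on lower levels would be unbounded and are dropped.
    have hmem : (fun r : {r // j ≤ g₀ r} => if g₀ r = j then (1 : ℚ) else 0) ∈
        closure {b : {r // j ≤ g₀ r} → ℚ | ∃ x : Fin v → ℚ, (∀ j, 0 ≤ x j) ∧
          ∑ t, x t • (fun r : {r // j ≤ g₀ r} => B r t) = b} := by
      rw [Metric.mem_closure_iff]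
      intro ε hε
      obtain ⟨N₀, hN₀⟩ := exists_nat_one_div_lt hε
      obtain ⟨N, hN, hNN⟩ := hg₀.exists_gt N₀
      have hNg : g N = g₀ := hN
      set y : Fin u → ℚ := fun r => ∑ t, B r t * x N t with hy
      have hyp : ∀ r, 0 < y r := hpos N
      refine ⟨_, ⟨fun t => x N t / y r₀, fun t => div_nonneg (hx N t) (hyp r₀).le, rfl⟩, ?_⟩
      rw [dist_pi_lt_iff hε]
      rintro ⟨r, hr⟩
      have hval : (∑ t, (x N t / y r₀) • fun r : {r // j ≤ g₀ r} => B r t) ⟨r, hr⟩ =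
          y r / y r₀ := by
        simp only [Finset.sum_apply, Pi.smul_apply, smul_eq_mul, hy, Finset.sum_div]
        exact Finset.sum_congr rfl fun t _ => by ring
      rw [hval]
      have hN1 : (0 : ℚ) < ((N + 1 : ℕ) : ℚ) := by positivity
      have hlt' : (1 : ℝ) / ((N + 1 : ℕ) : ℝ) < ε := by
        refine lt_trans ?_ hN₀
        apply one_div_lt_one_div_of_lt
        · positivity
        · exact_mod_cast (by omega : N₀ + 1 < N + 1)
      refine lt_of_le_of_lt ?_ hlt'
      suffices h : |(if g₀ r = j then (1 : ℚ) else 0) - y r / y r₀| ≤ 1 / ((N + 1 : ℕ) : ℚ) by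
        rw [Rat.dist_eq, ← Rat.cast_sub, ← Rat.cast_abs]
        have h' := (Rat.cast_le (K := ℝ)).2 h
        rwa [Rat.cast_div, Rat.cast_one, Rat.cast_natCast] at h'
      have hy0 := hyp r₀
      have hyr := hyp r
      split_ifs with h
      · have h1 : y r ≤ (1 + 1 / ((N + 1 : ℕ) : ℚ)) * y r₀ := heq N r r₀ (by rw [hNg, h, hr₀])
        have h2 : y r₀ ≤ (1 + 1 / ((N + 1 : ℕ) : ℚ)) * y r := heq N r₀ r (by rw [hNg, h, hr₀])
        set δ := 1 / ((N + 1 : ℕ) : ℚ)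
        have hδ : 0 < δ := by positivity
        have h3 : y r / y r₀ ≤ 1 + δ := (div_le_iff₀ hy0).2 h1
        have h4 : 1 - δ ≤ y r / y r₀ := by
          rw [le_div_iff₀ hy0]
          by_cases hδ1 : δ ≤ 1
          · nlinarith [mul_nonneg (sub_nonneg.2 hδ1) (sub_nonneg.2 h2),
              mul_nonneg (mul_nonneg hδ.le hδ.le) hyr.le]
          · nlinarith
        rw [abs_le]
        constructor <;> linarith
      · have hjr : g₀ r₀ < g₀ r := hr₀ ▸ lt_of_le_of_ne hr (fun h' => h h'.symm)
        have h1 : ((N + 1 : ℕ) : ℚ) * y r ≤ y r₀ := hlt N r₀ r (by rw [hNg]; exact hjr)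
        rw [zero_sub, abs_neg, abs_of_nonneg (by positivity), div_le_div_iff₀ hy0 hN1]
        linarith
    rw [hcl.closure_eq] at hmem
    obtain ⟨z, hz, hzr⟩ := hmem
    refine ⟨z, hz, fun r hr => ?_⟩
    have := congrFun hzr ⟨r, hr⟩
    rw [← this]
    simp only [Finset.sum_apply, Pi.smul_apply, smul_eq_mul]
    exact Finset.sum_congr rfl fun t _ => by ring
  choose X hX hXr using this
  exact ⟨X, hX, hXr⟩

theorem exists_common_denominator {ι : Type*} [Fintype ι] (f : ι → ℚ) :
    ∃ d : ℕ, 0 < d ∧ ∀ i, ∃ z : ℤ, (d : ℚ) * f i = z := by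
  classical
  refine ⟨∏ i, (f i).den, Finset.prod_pos fun i _ => (f i).den_pos, fun i => ?_⟩
  obtain ⟨k, hk⟩ := Finset.dvd_prod_of_mem (fun i => (f i).den) (Finset.mem_univ i)
  refine ⟨k * (f i).num, ?_⟩
  rw [hk]
  push_cast
  have := Rat.mul_den_eq_num (f i)
  linear_combination (k : ℚ) * this

/-- Every member of a minimal idempotent contains an image of every finite image partition
regular matrix. -/
theorem IsIPR.exists_image_subset_of_mem {u v : ℕ} {B : Matrix (Fin u) (Fin v) ℚ} (hB : IsIPR B)
    {p : Ultrafilter ℕ+} (hp : IsMinimalIdempotent p) {A : Set ℕ+} (hA : A ∈ p) :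
    ∃ x : Fin v → ℕ+, image B x ⊆ toRat A := by
  obtain ⟨g, X, hX0, hX⟩ := hB.exists_staircase
  obtain ⟨d₁, hd₁, hd₁B⟩ := exists_common_denominator (fun rt : Fin u × Fin v => B rt.1 rt.2)
  obtain ⟨d₂, hd₂, hd₂X⟩ := exists_common_denominator
    (fun jt : Fin (u + 1) × Fin v => X jt.1 jt.2)
  choose b hb using fun (r : Fin u) (t : Fin v) => hd₁B (r, t)
  have hN : ∀ (j : Fin (u + 1)) (t : Fin v), ∃ n : ℕ, (d₂ : ℚ) * X j t = n := by
    intro j t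
    obtain ⟨z, hz⟩ := hd₂X (j, t)
    have h0 : 0 ≤ z := by
      have := hX0 j t
      have h1 : (0 : ℚ) ≤ z := by rw [← hz]; positivity
      exact_mod_cast h1
    lift z to ℕ using h0
    exact ⟨z, by simpa using hz⟩
  choose x hx using hN
  dsimp only at hb
  let h : Fin u → (Fin v → ℕ) →+ ℤ := fun r =>
    { toFun := fun y => ∑ t, b r t * y t
      map_zero' := by simp
      map_add' := fun y z => by
        rw [← Finset.sum_add_distrib]
        exact Finset.sum_congr rfl fun t _ => by simp; ring }
  -- A crude bound for all coefficients, making `σ + h r` nonnegative for every `r`.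
  let C : ℕ := ∑ r, ∑ t, (b r t).natAbs
  let σ : (Fin v → ℕ) →+ ℕ :=
    { toFun := fun y => ∑ t, C * y t
      map_zero' := by simp
      map_add' := fun y z => by
        rw [← Finset.sum_add_distrib]
        exact Finset.sum_congr rfl fun t _ => by simp; ring }
  have hbC : ∀ r t, (b r t).natAbs ≤ C := fun r t =>
    (Finset.single_le_sum (f := fun t => (b r t).natAbs) (fun _ _ => Nat.zero_le _)
      (Finset.mem_univ t)).trans
    (Finset.single_le_sum (f := fun r => ∑ t, (b r t).natAbs) (fun _ _ => Nat.zero_le _)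
      (Finset.mem_univ r))
  have hhx : ∀ (r : Fin u) (j : Fin (u + 1)), j ≤ g r →
      h r (x j) = if g r = j then ((d₁ * d₂ : ℕ) : ℤ) else 0 := by
    intro r j hj
    have h1 : ((h r (x j) : ℤ) : ℚ) = d₁ * d₂ * ∑ t, B r t * X j t := by
      simp only [h, AddMonoidHom.coe_mk, ZeroHom.coe_mk]
      push_cast
      rw [Finset.mul_sum]
      refine Finset.sum_congr rfl fun t _ => ?_
      rw [← hb, ← hx]
      ring
    rw [hX j r hj] at h1
    split_ifs at h1 ⊢ with hg
    · have : ((h r (x j) : ℤ) : ℚ) = ((d₁ * d₂ : ℕ) : ℤ) := by rw [h1]; push_cast; ring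
      exact_mod_cast this
    · simpa using h1
  obtain ⟨W, hWpos, hW⟩ := exists_ultrafilter_of_staircase hp
    (P := {y : Fin v → ℕ | ∀ t, 0 < y t}) ⟨fun _ => 1, fun _ => one_pos⟩
    (fun y hy z t => Nat.add_pos_left (hy t) _) h (fun r => g r)
    (fun j => if hj : j < u + 1 then x ⟨j, hj⟩ else 0) ⟨d₁ * d₂, by positivity⟩
    (by
      intro r
      simp only [(g r).2, dif_pos]
      rw [hhx r _ le_rfl, if_pos rfl]
      rfl)
    (by
      intro r j hj
      have hj' : j < u + 1 := hj.trans (g r).2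
      simp only [hj', dif_pos]
      have hne : g r ≠ ⟨j, hj'⟩ := by
        rintro heq
        rw [heq] at hj
        exact lt_irrefl _ hj
      rw [hhx r ⟨j, hj'⟩ (Fin.le_def.2 hj.le), if_neg hne])
    σ
    (by
      intro r y
      simp only [h, σ, AddMonoidHom.coe_mk, ZeroHom.coe_mk]
      push_cast
      rw [← Finset.sum_add_distrib]
      refine Finset.sum_nonneg fun t _ => ?_
      rw [← add_mul]
      refine mul_nonneg ?_ (by positivity)
      have := hbC r t
      omega)
    (u + 1) (fun r => (g r).2) 0 (Nat.zero_le _)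
  have hall : ∀ᶠ y in (W : Filter (Fin v → ℕ)), ∀ r, ∃ a ∈ A, h r y = ((a : ℕ) : ℤ) := by
    rw [eventually_all]
    intro r
    have : (fun n : ℕ+ => ((n : ℕ) : ℤ)) '' A ∈ W.map (h r) := by
      rw [hW r (Nat.zero_le _)]
      exact Filter.image_mem_map hA
    filter_upwards [this] with y hy
    obtain ⟨a, ha, hay⟩ := hy
    exact ⟨a, ha, hay.symm⟩
  obtain ⟨y, hy, hypos⟩ := (hall.and hWpos).exists
  -- The functionals `h r` are the rows of `d₁ • B`; the factor `d₁` moves back into the vector.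
  obtain ⟨z, hz⟩ : ∃ z : Fin v → ℕ+, ∀ t, (z t : ℕ) = d₁ * y t :=
    ⟨fun t => ⟨d₁ * y t, Nat.mul_pos hd₁ (hypos t)⟩, fun _ => rfl⟩
  refine ⟨z, ?_⟩
  rintro _ ⟨r, rfl⟩
  obtain ⟨a, ha, hay⟩ := hy r
  refine ⟨a, ha, ?_⟩
  rw [apply_eq_sum]
  have h2 : ((h r y : ℤ) : ℚ) = ((a : ℕ) : ℚ) := by rw [hay]; simp
  simp only [h, AddMonoidHom.coe_mk, ZeroHom.coe_mk] at h2
  dsimp only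
  rw [← h2]
  push_cast
  refine Finset.sum_congr rfl fun t _ => ?_
  rw [← hb, hz]
  push_cast
  ring

/-! ### Sequences of finite sets with sums in a given member of an idempotent -/

/-- The successive choice of finite sets, relative to an idempotent ultrafilter: all sums lie
in `A`, and later sums lie in the sets `Q` prescribed by earlier sums. -/
theorem exists_seq_of_idempotent {p : Ultrafilter ℕ+} (hp : p + p = p)
    (𝒴 : ℕ → Set (Finset ℕ+)) (h𝒴 : ∀ n, ∀ A ∈ p, ∃ Y ∈ 𝒴 n, (Y : Set ℕ+) ⊆ A)
    {A : Set ℕ+} (hA : A ∈ p) (Q : ℕ+ → Set ℕ+) (hQ : ∀ x ∈ A, Q x ∈ p) :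
    ∃ Y : ℕ → Finset ℕ+, (∀ n, Y n ∈ 𝒴 n) ∧
      (∀ (F : Finset ℕ) (x : ℕ → ℕ+), F.Nonempty → (∀ t ∈ F, x t ∈ Y t) →
        ∃ a ∈ A, (a : ℕ) = ∑ t ∈ F, (x t : ℕ)) ∧
      ∀ (F G : Finset ℕ) (x : ℕ → ℕ+), F.Nonempty → G.Nonempty → (∀ s ∈ F, ∀ t ∈ G, s < t) →
        (∀ t ∈ F, x t ∈ Y t) → (∀ t ∈ G, x t ∈ Y t) →
        ∃ a b : ℕ+, (a : ℕ) = ∑ t ∈ F, (x t : ℕ) ∧ (b : ℕ) = ∑ t ∈ G, (x t : ℕ) ∧ b ∈ Q a := by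
  classical
  -- The default `Set.univ` allows intersecting over all sums before they are known to lie in `A`.
  let Q' : ℕ+ → Set ℕ+ := fun x => if Q x ∈ p then Q x else Set.univ
  have hQ' : ∀ x, Q' x ∈ p := fun x => by
    simp only [Q']
    split_ifs with h
    exacts [h, univ_mem]
  have hstar : ∀ R ∈ p, {x | {y | x + y ∈ R} ∈ p} ∈ p := by
    intro R hR
    have : R ∈ p + p := by rwa [hp]
    exact this
  have hchoose : ∀ (n : ℕ) (R : {R : Set ℕ+ // R ∈ p}), ∃ Y ∈ 𝒴 n,
      (Y : Set ℕ+) ⊆ R.1 ∩ {x | {y | x + y ∈ R.1} ∈ p} := fun n R =>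
    h𝒴 n _ (inter_mem R.2 (hstar _ R.2))
  choose Z hZ𝒴 hZ using hchoose
  let T' : ℕ → {R : Set ℕ+ // R ∈ p} → Finset ℕ+ → Finset ℕ+ := fun n R T =>
    T ∪ Z n R ∪ (T + Z n R)
  -- The state is a reservoir in `p` for later sums together with the finite set of sums formed so
  -- far. The reservoir shrinks so that adding a term just chosen returns to the old reservoir, and
  -- so that it lies in `Q' x` for every sum `x` formed.
  let step : ℕ → {R : Set ℕ+ // R ∈ p} × Finset ℕ+ → {R : Set ℕ+ // R ∈ p} × Finset ℕ+ :=
    fun n s => (⟨s.1.1 ∩ (⋂ y ∈ Z n s.1, {z | y + z ∈ s.1.1}) ∩ ⋂ x ∈ T' n s.1 s.2, Q' x,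
      inter_mem (inter_mem s.1.2 ((biInter_finset_mem _).2 fun y hy => (hZ n s.1 hy).2))
        ((biInter_finset_mem _).2 fun x _ => hQ' x)⟩, T' n s.1 s.2)
  let st : ℕ → {R : Set ℕ+ // R ∈ p} × Finset ℕ+ := fun n =>
    Nat.rec (⟨A, hA⟩, ∅) step n
  have hst : ∀ n, st (n + 1) = step n (st n) := fun n => rfl
  let R : ℕ → Set ℕ+ := fun n => (st n).1.1
  let T : ℕ → Finset ℕ+ := fun n => (st n).2
  let Y : ℕ → Finset ℕ+ := fun n => Z n (st n).1
  have hYR : ∀ n, ∀ y ∈ Y n, y ∈ R n := fun n y hy => (hZ n (st n).1 hy).1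
  have hRsucc : ∀ n, R (n + 1) ⊆ R n := fun n z hz => hz.1.1
  have hRanti : Antitone R := antitone_nat_of_succ_le hRsucc
  have hRadd : ∀ n, ∀ y ∈ Y n, ∀ z ∈ R (n + 1), y + z ∈ R n := fun n y hy z hz =>
    Set.mem_iInter₂.1 hz.1.2 y hy
  have hRQ : ∀ n, ∀ x ∈ T (n + 1), R (n + 1) ⊆ Q' x := fun n x hx z hz =>
    Set.mem_iInter₂.1 hz.2 x hx
  have hTsucc : ∀ n, T (n + 1) = T n ∪ Y n ∪ (T n + Y n) := fun n => rfl
  have hTmono : Monotone T := monotone_nat_of_le_succ fun n x hx => by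
    rw [hTsucc]; simp [hx]
  have hR : ∀ (k : ℕ) (F : Finset ℕ) (x : ℕ → ℕ+), F.card = k → F.Nonempty →
      (∀ t ∈ F, x t ∈ Y t) → ∀ n, (∀ t ∈ F, n ≤ t) →
      ∃ a ∈ R n, (a : ℕ) = ∑ t ∈ F, (x t : ℕ) := by
    intro k
    induction k with
    | zero =>
      intro F x hk hF
      simp [Finset.card_eq_zero.1 hk] at hF
    | succ k ih =>
      intro F x hk hF hx n hn
      have hm := F.min'_mem hF
      set m := F.min' hF
      have hnm : n ≤ m := hn m hm
      rw [← Finset.add_sum_erase F _ hm]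
      rcases (F.erase m).eq_empty_or_nonempty with h | h
      · exact ⟨x m, hRanti hnm (hYR m _ (hx m hm)), by simp [h]⟩
      · obtain ⟨a, ha, hae⟩ := ih (F.erase m) x (by rw [Finset.card_erase_of_mem hm, hk]; rfl) h
          (fun t ht => hx t (Finset.mem_of_mem_erase ht)) (m + 1)
          (fun t ht => lt_of_le_of_ne (F.min'_le t (Finset.mem_of_mem_erase ht))
            (Finset.ne_of_mem_erase ht).symm)
        exact ⟨x m + a, hRanti hnm (hRadd m _ (hx m hm) a ha), by rw [← hae]; simp⟩
  have hT : ∀ (n : ℕ) (F : Finset ℕ) (x : ℕ → ℕ+), F.Nonempty → (∀ t ∈ F, t < n) →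
      (∀ t ∈ F, x t ∈ Y t) → ∃ a ∈ T n, (a : ℕ) = ∑ t ∈ F, (x t : ℕ) := by
    intro n
    induction n with
    | zero =>
      rintro F x ⟨t, ht⟩ hF
      exact absurd (hF t ht) (Nat.not_lt_zero _)
    | succ n ih =>
      intro F x hF hn hx
      rw [hTsucc]
      by_cases hnF : n ∈ F
      · rw [← Finset.add_sum_erase F _ hnF]
        rcases (F.erase n).eq_empty_or_nonempty with h | h
        · exact ⟨x n, by simp [hx n hnF], by simp [h]⟩
        · obtain ⟨a, ha, hae⟩ := ih (F.erase n) x h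
            (fun t ht => lt_of_le_of_ne (Nat.lt_succ_iff.1 (hn t (Finset.mem_of_mem_erase ht)))
              (Finset.ne_of_mem_erase ht))
            (fun t ht => hx t (Finset.mem_of_mem_erase ht))
          refine ⟨a + x n, ?_, by rw [← hae]; simp [add_comm]⟩
          exact Finset.mem_union_right _ (Finset.add_mem_add ha (hx n hnF))
      · obtain ⟨a, ha, hae⟩ := ih F x hF (fun t ht => lt_of_le_of_ne (Nat.lt_succ_iff.1 (hn t ht))
          (fun h => hnF (h ▸ ht))) hx
        exact ⟨a, by simp [ha], hae⟩
  refine ⟨Y, fun n => hZ𝒴 n _, fun F x hF hx => ?_, fun F G x hF hG hFG hxF hxG => ?_⟩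
  · exact hR _ F x rfl hF hx 0 fun _ _ => Nat.zero_le _
  · have hm := F.max'_mem hF
    set m := F.max' hF
    obtain ⟨a, haT, ha⟩ := hT (m + 1) F x hF (fun t ht => Nat.lt_succ_of_le (F.le_max' t ht)) hxF
    obtain ⟨b, hbR, hb⟩ := hR _ G x rfl hG hxG (m + 1) fun t ht => hFG m hm t ht
    obtain ⟨a', ha'A, ha'⟩ := hR _ F x rfl hF hxF 0 fun _ _ => Nat.zero_le _
    obtain rfl : a = a' := PNat.coe_inj.1 (ha.trans ha'.symm)
    refine ⟨a, b, ha, hb, ?_⟩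
    have := hRQ m a haT hbR
    simpa only [Q', if_pos (hQ a ha'A)] using this

theorem exists_finset_toRat_eq_image {u v : ℕ} {B : Matrix (Fin u) (Fin v) ℚ} {A : Set ℕ+}
    {x : Fin v → ℕ+} (hx : image B x ⊆ toRat A) :
    ∃ Y : Finset ℕ+, toRat (Y : Set ℕ+) = image B x ∧ (Y : Set ℕ+) ⊆ A := by
  classical
  choose y hyA hy using fun r => hx ⟨r, rfl⟩
  refine ⟨Finset.univ.image y, ?_, ?_⟩
  · ext z
    simp only [toRat, image, Finset.coe_image, Finset.coe_univ, Set.image_univ, Set.mem_image,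
      Set.mem_range, exists_exists_eq_and]
    exact exists_congr fun r => by rw [← hy r]
  · intro z hz
    obtain ⟨r, -, rfl⟩ := Finset.mem_image.1 (Finset.mem_coe.1 hz)
    exact hyA r

theorem exists_pnat_seq {Y : ℕ → Set ℕ+} {F : Finset ℕ} {x : ℕ → ℚ}
    (h : ∀ t ∈ F, x t ∈ toRat (Y t)) :
    ∃ x' : ℕ → ℕ+, ∀ t ∈ F, x' t ∈ Y t ∧ ((x' t : ℕ) : ℚ) = x t := by
  have : ∀ t, ∃ n : ℕ+, t ∈ F → n ∈ Y t ∧ ((n : ℕ) : ℚ) = x t := by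
    intro t
    by_cases ht : t ∈ F
    · obtain ⟨n, hn, hn'⟩ := h t ht
      exact ⟨n, fun _ => ⟨hn, hn'⟩⟩
    · exact ⟨1, fun h => absurd h ht⟩
  choose x' hx' using this
  exact ⟨x', hx'⟩

theorem mem_MT_two_one {Y : ℕ → Set ℚ} {z : ℚ} :
    z ∈ MT ![2, 1] Y ↔ ∃ (F G : Finset ℕ) (x : ℕ → ℚ), F.Nonempty ∧ G.Nonempty ∧
      (∀ s ∈ F, ∀ t ∈ G, s < t) ∧ (∀ t ∈ F, x t ∈ Y t) ∧ (∀ t ∈ G, x t ∈ Y t) ∧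
      z = 2 * ∑ t ∈ F, x t + ∑ t ∈ G, x t := by
  have hsum : ∀ (F : Fin 2 → Finset ℕ) (x : ℕ → ℚ),
      ∑ i : Fin 2, ((![2, 1] i : ℤ) : ℚ) * ∑ t ∈ F i, x t =
        2 * ∑ t ∈ F 0, x t + ∑ t ∈ F 1, x t := by
    intro F x
    simp [Fin.sum_univ_two]
  constructor
  · rintro ⟨F, x, hF, hFF, hx, rfl⟩
    exact ⟨F 0, F 1, x, hF 0, hF 1, hFF 0 1 (by decide), hx 0, hx 1, hsum F x⟩
  · rintro ⟨F, G, x, hF, hG, hFG, hxF, hxG, rfl⟩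
    refine ⟨![F, G], x, Fin.forall_fin_two.2 ⟨hF, hG⟩, ?_, Fin.forall_fin_two.2 ⟨hxF, hxG⟩,
      (hsum ![F, G] x).symm⟩
    refine Fin.forall_fin_two.2 ⟨Fin.forall_fin_two.2 ⟨fun h => ?_, fun _ => hFG⟩,
      Fin.forall_fin_two.2 ⟨fun h => ?_, fun h => ?_⟩⟩
    exacts [absurd h (lt_irrefl _), absurd h (by decide), absurd h (lt_irrefl _)]

/-- Every member of a minimal idempotent contains `FS(⟨Yₙ⟩) ∪ (b + MT(⟨2, 1⟩, ⟨Yₙ⟩))` for suitable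
images `Yₙ` of the given finite image partition regular matrices. -/
theorem exists_FS_union_MT_subset (B : ℕ → FiniteIPRMatrix) {p : Ultrafilter ℕ+}
    (hp : IsMinimalIdempotent p) {A : Set ℕ+} (hA : A ∈ p) :
    ∃ (b : ℕ+) (Y : ℕ → Finset ℕ+),
      (∀ n, ∃ x : Fin (B n).v → ℕ+, toRat (Y n : Set ℕ+) = image (B n).mat x) ∧
      FS (fun n => toRat (Y n : Set ℕ+)) ∪
        (((b : ℕ) : ℚ) +ᵥ MT ![2, 1] (fun n => toRat (Y n : Set ℕ+))) ⊆ toRat A := by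
  -- The source of the translation: `b` is a point of a suitable member of `s`.
  obtain ⟨s, hs⟩ := exists_eq_add_add_of_mem_smallestIdeal hp.2 (p.map fun x => x + x)
  have hA' : ∀ᶠ z in (s + (p.map (fun x => x + x) + p) : Ultrafilter ℕ+), z ∈ A := by
    rw [hs]; exact hA
  rw [Ultrafilter.eventually_add] at hA'
  obtain ⟨b, hb⟩ := hA'.exists
  rw [Ultrafilter.eventually_add, Ultrafilter.coe_map, eventually_map] at hb
  obtain ⟨Y, hY, hFS, hMT⟩ := exists_seq_of_idempotent hp.1
    (fun n => {Y | ∃ x : Fin (B n).v → ℕ+, toRat (Y : Set ℕ+) = image (B n).mat x})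
    (fun n R hR => by
      obtain ⟨x, hx⟩ := (B n).isIPR.exists_image_subset_of_mem hp hR
      obtain ⟨Y, hY, hYR⟩ := exists_finset_toRat_eq_image hx
      exact ⟨Y, ⟨x, hY⟩, hYR⟩)
    (inter_mem hA hb) (fun x => {y | b + (x + x + y) ∈ A}) (fun x hx => hx.2)
  refine ⟨b, Y, hY, Set.union_subset ?_ ?_⟩
  · rintro _ ⟨F, x, hF, hx, rfl⟩
    obtain ⟨x', hx'⟩ := exists_pnat_seq hx
    obtain ⟨a, ha, hae⟩ := hFS F x' hF fun t ht => (hx' t ht).1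
    refine ⟨a, ha.1, ?_⟩
    dsimp only
    rw [hae]
    push_cast
    exact Finset.sum_congr rfl fun t ht => (hx' t ht).2
  · rintro _ ⟨_, hz, rfl⟩
    obtain ⟨F, G, x, hF, hG, hFG, hxF, hxG, rfl⟩ := mem_MT_two_one.1 hz
    have hx : ∀ t ∈ F ∪ G, x t ∈ toRat (Y t : Set ℕ+) := by
      intro t ht
      rcases Finset.mem_union.1 ht with h | h
      exacts [hxF t h, hxG t h]
    obtain ⟨x', hx'⟩ := exists_pnat_seq hx
    have hx'F := fun t ht => hx' t (Finset.mem_union_left G ht)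
    have hx'G := fun t ht => hx' t (Finset.mem_union_right F ht)
    obtain ⟨a, c, ha, hc, hac⟩ := hMT F G x' hF hG hFG (fun t ht => (hx'F t ht).1)
      (fun t ht => (hx'G t ht).1)
    refine ⟨_, hac, ?_⟩
    rw [← Finset.sum_congr rfl fun t ht => (hx'F t ht).2,
      ← Finset.sum_congr rfl fun t ht => (hx'G t ht).2, ← Nat.cast_sum, ← Nat.cast_sum, ← ha, ← hc]
    simp only [vadd_eq_add, PNat.add_coe]
    push_cast
    ring

/-! ### Rows of a DH-matrix -/

/-- `r` is the row which follows row `i n` of `B n` for `n ∈ F` and is zero elsewhere. -/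
def IsDHRow (B : ℕ → FiniteIPRMatrix) (F : Finset ℕ) (i : (n : ℕ) → Fin (B n).u)
    (r : ℕ → ℚ) : Prop :=
  ∀ (n : ℕ) (t : Fin (B n).v),
    r (blockStart B n + t) = if n ∈ F then (B n).mat (i n) t else 0

theorem blockStart_succ (B : ℕ → FiniteIPRMatrix) (n : ℕ) :
    blockStart B (n + 1) = blockStart B n + (B n).v :=
  Finset.sum_range_succ _ _

theorem blockStart_mono (B : ℕ → FiniteIPRMatrix) : Monotone (blockStart B) :=
  monotone_nat_of_le_succ fun n => by rw [blockStart_succ]; omega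

theorem bijective_blockStart_add (B : ℕ → FiniteIPRMatrix) :
    Function.Bijective fun z : (n : ℕ) × Fin (B n).v => blockStart B z.1 + z.2 := by
  constructor
  · rintro ⟨n, s⟩ ⟨m, t⟩ h
    dsimp only at h
    have hs := s.2
    have ht := t.2
    obtain rfl : n = m := by
      rcases lt_trichotomy n m with hnm | hnm | hnm
      · have := blockStart_mono B (Nat.succ_le_of_lt hnm)
        rw [Nat.succ_eq_add_one, blockStart_succ] at this
        omega
      · exact hnm
      · have := blockStart_mono B (Nat.succ_le_of_lt hnm)
        rw [Nat.succ_eq_add_one, blockStart_succ] at this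
        omega
    obtain rfl : s = t := Fin.ext (by omega)
    rfl
  · intro m
    induction m with
    | zero => exact ⟨⟨0, ⟨0, (B 0).v_pos⟩⟩, by simp [blockStart]⟩
    | succ m ih =>
      obtain ⟨⟨n, t⟩, h⟩ := ih
      dsimp only at h
      by_cases ht : (t : ℕ) + 1 < (B n).v
      · exact ⟨⟨n, ⟨t + 1, ht⟩⟩, by dsimp only; omega⟩
      · refine ⟨⟨n + 1, ⟨0, (B _).v_pos⟩⟩, ?_⟩
        have := t.2
        simp only [blockStart_succ]
        omega

/-- The columns of a DH-matrix, listed by blocks. -/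
noncomputable def columnEquiv (B : ℕ → FiniteIPRMatrix) : ((n : ℕ) × Fin (B n).v) ≃ ℕ :=
  Equiv.ofBijective _ (bijective_blockStart_add B)

theorem columnEquiv_apply (B : ℕ → FiniteIPRMatrix) (n : ℕ) (t : Fin (B n).v) :
    columnEquiv B ⟨n, t⟩ = blockStart B n + t := rfl

theorem exists_concatenation {α : Type*} (B : ℕ → FiniteIPRMatrix)
    (x : (n : ℕ) → Fin (B n).v → α) :
    ∃ X : ℕ → α, ∀ (n : ℕ) (t : Fin (B n).v), X (blockStart B n + t) = x n t := by
  refine ⟨fun m => x ((columnEquiv B).symm m).1 ((columnEquiv B).symm m).2, fun n t => ?_⟩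
  beta_reduce
  rw [← columnEquiv_apply, Equiv.symm_apply_apply]

theorem exists_isDHRow (B : ℕ → FiniteIPRMatrix) (F : Finset ℕ) (i : (n : ℕ) → Fin (B n).u) :
    ∃ r, IsDHRow B F i r :=
  exists_concatenation B fun n t => if n ∈ F then (B n).mat (i n) t else 0

theorem IsDHRow.support_subset {B : ℕ → FiniteIPRMatrix} {F : Finset ℕ}
    {i : (n : ℕ) → Fin (B n).u} {r : ℕ → ℚ} (hr : IsDHRow B F i r) :
    {m | r m ≠ 0} ⊆ columnEquiv B '' (F.sigma fun n => (Finset.univ : Finset (Fin (B n).v)) : Finset _) := by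
  intro m hm
  obtain ⟨⟨n, t⟩, rfl⟩ := (columnEquiv B).surjective m
  refine ⟨⟨n, t⟩, ?_, rfl⟩
  by_contra h
  apply hm
  rw [columnEquiv_apply, hr n t, if_neg]
  simpa using h

theorem IsDHRow.finite_support {B : ℕ → FiniteIPRMatrix} {F : Finset ℕ}
    {i : (n : ℕ) → Fin (B n).u} {r : ℕ → ℚ} (hr : IsDHRow B F i r) : {m | r m ≠ 0}.Finite :=
  ((Finset.finite_toSet _).image _).subset hr.support_subset

theorem IsDHRow.finsum_mul {B : ℕ → FiniteIPRMatrix} {F : Finset ℕ}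
    {i : (n : ℕ) → Fin (B n).u} {r : ℕ → ℚ} (hr : IsDHRow B F i r) (X : ℕ → ℕ+) :
    ∑ᶠ m, r m * ((X m : ℕ) : ℚ) =
      ∑ n ∈ F, apply (B n).mat (fun t => X (blockStart B n + t)) (i n) := by
  rw [← finsum_comp_equiv (columnEquiv B),
    finsum_eq_sum_of_support_subset (s := F.sigma fun _ => Finset.univ), Finset.sum_sigma]
  · refine Finset.sum_congr rfl fun n hn => ?_
    rw [apply_eq_sum]
    refine Finset.sum_congr rfl fun t _ => ?_
    rw [columnEquiv_apply, hr n t, if_pos hn]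
  · rintro ⟨n, t⟩ h
    by_contra h'
    apply h
    beta_reduce
    rw [columnEquiv_apply, hr n t, if_neg, zero_mul]
    simpa using h'

theorem IsDHMatrix.exists_isDHRow {B : ℕ → FiniteIPRMatrix} {D : Matrix ℕ ℕ ℚ}
    (hD : IsDHMatrix B D) (k : ℕ) :
    ∃ (F : Finset ℕ) (i : (n : ℕ) → Fin (B n).u), F.Nonempty ∧ IsDHRow B F i (D k) := by
  have : D k ∈ dhRows B := by
    rw [← hD]
    exact ⟨k, rfl⟩
  exact this

theorem IsDHMatrix.exists_index {B : ℕ → FiniteIPRMatrix} {D : Matrix ℕ ℕ ℚ}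
    (hD : IsDHMatrix B D) {F : Finset ℕ} (hF : F.Nonempty) (i : (n : ℕ) → Fin (B n).u) :
    ∃ k, IsDHRow B F i (D k) := by
  obtain ⟨r, hr⟩ := DH.exists_isDHRow B F i
  have : r ∈ Set.range fun k => D k := by
    rw [hD]
    exact ⟨F, i, hF, hr⟩
  obtain ⟨k, hk⟩ := this
  refine ⟨k, ?_⟩
  change D k = r at hk
  rwa [hk]

theorem IsDHMatrix.rowFinite {B : ℕ → FiniteIPRMatrix} {D : Matrix ℕ ℕ ℚ}
    (hD : IsDHMatrix B D) : RowFinite D := fun k => by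
  obtain ⟨F, i, -, hr⟩ := hD.exists_isDHRow k
  exact hr.finite_support

/-! ### Extending a DH-matrix by Milliken-Taylor rows -/

/-- Pairs of rows of `D` in which the blocks of the first precede the blocks of the second. -/
def SeparatedRows (B : ℕ → FiniteIPRMatrix) (D : Matrix ℕ ℕ ℚ) : Type :=
  {k : ℕ × ℕ // ∃ (F G : Finset ℕ) (i j : (n : ℕ) → Fin (B n).u), F.Nonempty ∧ G.Nonempty ∧
    (∀ s ∈ F, ∀ t ∈ G, s < t) ∧ IsDHRow B F i (D k.1) ∧ IsDHRow B G j (D k.2)}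

/-- The matrix with an additional first column whose images are
`FS(⟨Yₙ⟩) ∪ (b + MT(⟨2, 1⟩, ⟨Yₙ⟩))`. -/
def extend (B : ℕ → FiniteIPRMatrix) (D : Matrix ℕ ℕ ℚ) :
    Matrix (ℕ ⊕ SeparatedRows B D) (Option ℕ) ℚ
  | .inl _, none => 0
  | .inl k, some m => D k m
  | .inr _, none => 1
  | .inr k, some m => 2 * D k.1.1 m + D k.1.2 m

theorem finsum_option {α : Type*} (f : Option α → ℚ) (hf : {a | f (some a) ≠ 0}.Finite) :
    ∑ᶠ o, f o = f none + ∑ᶠ a, f (some a) := by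
  have hr : (Set.range (some : α → Option α) ∩ Function.support f).Finite := by
    refine (hf.image some).subset ?_
    rintro _ ⟨⟨a, rfl⟩, ha⟩
    exact ⟨a, ha, rfl⟩
  rw [← finsum_mem_univ, ← Set.insert_none_range_some, finsum_mem_insert' _ (by simp) hr,
    finsum_mem_range (Option.some_injective _)]

theorem rowFinite_extend (B : ℕ → FiniteIPRMatrix) {D : Matrix ℕ ℕ ℚ} (hD : RowFinite D) :
    RowFinite (extend B D) := by
  rintro (k | k)
  · refine ((hD k).image some).subset ?_
    rintro (_ | m) hm
    · exact absurd rfl hm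
    · exact ⟨m, hm, rfl⟩
  · refine ((((hD k.1.1).union (hD k.1.2)).image some).insert none).subset ?_
    rintro (_ | m) hm
    · exact Set.mem_insert _ _
    · refine Set.mem_insert_of_mem _ ⟨m, ?_, rfl⟩
      by_contra h
      simp only [Set.mem_union, Set.mem_ofPred_eq, not_or, not_not] at h
      exact hm (by simp [extend, h.1, h.2])

theorem apply_extend_inl (B : ℕ → FiniteIPRMatrix) {D : Matrix ℕ ℕ ℚ} (hD : RowFinite D)
    (x : Option ℕ → ℕ+) (k : ℕ) :
    apply (extend B D) x (.inl k) = apply D (fun m => x (some m)) k := by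
  unfold apply
  rw [finsum_option]
  · simp [extend]
  · refine (hD k).subset fun m hm => ?_
    exact left_ne_zero_of_mul hm

theorem apply_extend_inr (B : ℕ → FiniteIPRMatrix) {D : Matrix ℕ ℕ ℚ} (hD : RowFinite D)
    (x : Option ℕ → ℕ+) (k : SeparatedRows B D) :
    apply (extend B D) x (.inr k) = ((x none : ℕ) : ℚ) +
      (2 * apply D (fun m => x (some m)) k.1.1 + apply D (fun m => x (some m)) k.1.2) := by
  unfold apply
  have h1 : (Function.support fun m => D k.1.1 m * ((x (some m) : ℕ) : ℚ)).Finite :=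
    (hD k.1.1).subset fun m hm => left_ne_zero_of_mul hm
  have h2 : (Function.support fun m => D k.1.2 m * ((x (some m) : ℕ) : ℚ)).Finite :=
    (hD k.1.2).subset fun m hm => left_ne_zero_of_mul hm
  have h1' : (Function.support fun m => 2 * (D k.1.1 m * ((x (some m) : ℕ) : ℚ))).Finite :=
    h1.subset fun m hm => right_ne_zero_of_mul hm
  rw [finsum_option]
  · rw [mul_finsum' _ _ h1, ← finsum_add_distrib h1' h2]
    simp only [extend, one_mul]
    congr 1
    exact finsum_congr fun m => by ring
  · refine (((hD k.1.1).union (hD k.1.2))).subset fun m hm => ?_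
    by_contra h
    simp only [Set.mem_union, Set.mem_ofPred_eq, not_or, not_not] at h
    exact hm (by simp [extend, h.1, h.2])

theorem exists_mem_of_coloring {r : ℕ} (p : Ultrafilter ℕ+) (c : ℕ+ → Fin r) :
    ∃ k, {n | c n = k} ∈ p := by
  obtain ⟨k, hk⟩ := Ultrafilter.eq_pure_of_finite (p.map c)
  refine ⟨k, ?_⟩
  have : {j | j = k} ∈ p.map c := by rw [hk]; exact rfl
  exact this

/-- Part (1) for a colour class in a minimal idempotent: the vectors producing the `Yₙ` are
concatenated and `b` fills the extra column. -/
theorem isIPR_extend {B : ℕ → FiniteIPRMatrix} {D : Matrix ℕ ℕ ℚ} (hD : IsDHMatrix B D) :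
    IsIPR (extend B D) := by
  classical
  refine ⟨rowFinite_extend B hD.rowFinite, fun r c => ?_⟩
  obtain ⟨p, hp⟩ := exists_isMinimalIdempotent
  obtain ⟨k, hk⟩ := exists_mem_of_coloring p c
  obtain ⟨b, Y, hY, hsub⟩ := exists_FS_union_MT_subset B hp hk
  choose x hx using hY
  obtain ⟨X, hX⟩ := exists_concatenation B x
  have hX' : ∀ n, (fun t : Fin (B n).v => X (blockStart B n + t)) = x n := fun n =>
    funext fun t => hX n t
  have hrow : ∀ {F : Finset ℕ} {i : (n : ℕ) → Fin (B n).u} {k : ℕ}, IsDHRow B F i (D k) →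
      apply D X k = ∑ n ∈ F, apply (B n).mat (x n) (i n) := by
    intro F i k hr
    refine (hr.finsum_mul X).trans (Finset.sum_congr rfl fun n _ => ?_)
    rw [hX']
  refine ⟨fun o => o.elim b X, k, ?_⟩
  rintro _ ⟨j | j, rfl⟩
  · rw [apply_extend_inl B hD.rowFinite]
    obtain ⟨F, i, hF, hr⟩ := hD.exists_isDHRow j
    apply hsub
    left
    refine ⟨F, fun n => apply (B n).mat (x n) (i n), hF, fun t _ => ?_, hrow hr⟩
    beta_reduce
    rw [hx t]
    exact ⟨i t, rfl⟩
  · rw [apply_extend_inr B hD.rowFinite]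
    obtain ⟨⟨j₁, j₂⟩, F, G, i, i', hF, hG, hFG, hr, hr'⟩ := j
    apply hsub
    right
    have hFG' : ∀ n ∈ G, n ∉ F := fun n hn hn' => lt_irrefl _ (hFG n hn' n hn)
    refine ⟨2 * apply D X j₁ + apply D X j₂, mem_MT_two_one.2 ⟨F, G,
      fun n => if n ∈ F then apply (B n).mat (x n) (i n) else apply (B n).mat (x n) (i' n),
      hF, hG, hFG, fun t ht => ?_, fun t ht => ?_, ?_⟩, rfl⟩
    · beta_reduce
      rw [hx t, if_pos ht]
      exact ⟨i t, rfl⟩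
    · beta_reduce
      rw [hx t, if_neg (hFG' t ht)]
      exact ⟨i' t, rfl⟩
    · rw [hrow hr, hrow hr', Finset.sum_congr rfl fun n hn => if_pos hn,
        Finset.sum_congr rfl fun n hn => if_neg (hFG' n hn)]

theorem imageDominates_extend {B : ℕ → FiniteIPRMatrix} {D : Matrix ℕ ℕ ℚ} (hD : RowFinite D) :
    ImageDominates (extend B D) D := by
  intro x
  refine ⟨fun m => x (some m), ?_⟩
  rintro _ ⟨k, rfl⟩
  exact ⟨.inl k, apply_extend_inl B hD x k⟩

/-- Image partition regularity passes to image dominated matrices. -/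
theorem IsIPR.of_imageDominates {ι κ ι' κ' : Type} {A : Matrix ι κ ℚ} {B : Matrix ι' κ' ℚ}
    (hA : IsIPR A) (hAB : ImageDominates A B) (hB : RowFinite B) : IsIPR B := by
  refine ⟨hB, fun r c => ?_⟩
  obtain ⟨x, k, hx⟩ := hA.2 r c
  obtain ⟨y, hy⟩ := hAB x
  exact ⟨y, k, hy.trans hx⟩

/-! ### A sparse image of a DH-matrix -/

/-- Two partial sums starting at `n₀` agree mod `d`; `G` is the interval between them. -/
theorem exists_dvd_sum (y : ℕ → ℕ) (d : ℕ) (hd : 0 < d) (n₀ : ℕ) :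
    ∃ G : Finset ℕ, G.Nonempty ∧ (∀ t ∈ G, n₀ ≤ t) ∧ d ∣ ∑ t ∈ G, y t := by
  have : NeZero d := ⟨hd.ne'⟩
  have key : ∀ k l : ℕ, k < l → ((∑ t ∈ Finset.Ico n₀ (n₀ + k), y t : ℕ) : ZMod d) =
      ((∑ t ∈ Finset.Ico n₀ (n₀ + l), y t : ℕ) : ZMod d) →
      ∃ G : Finset ℕ, G.Nonempty ∧ (∀ t ∈ G, n₀ ≤ t) ∧ d ∣ ∑ t ∈ G, y t := by
    intro k l hkl h
    refine ⟨Finset.Ico (n₀ + k) (n₀ + l), ?_, ?_, ?_⟩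
    · rw [Finset.nonempty_Ico]
      omega
    · intro t ht
      rw [Finset.mem_Ico] at ht
      omega
    · rw [← Finset.sum_Ico_consecutive y (show n₀ ≤ n₀ + k by omega)
        (show n₀ + k ≤ n₀ + l by omega), Nat.cast_add, left_eq_add] at h
      exact (ZMod.natCast_eq_zero_iff _ _).1 h
  obtain ⟨k, l, hkl, h⟩ := Finite.exists_ne_map_eq_of_infinite
    fun k : ℕ => ((∑ t ∈ Finset.Ico n₀ (n₀ + k), y t : ℕ) : ZMod d)
  rcases lt_or_gt_of_ne hkl with hlt | hlt
  exacts [key k l hlt h, key l k hlt h.symm]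

/-- The natural numbers which are finite sums with at most one term from each `X n`. -/
def natFS (X : ℕ → Set ℕ) : Set ℕ :=
  {z | ∃ (F : Finset ℕ) (x : ℕ → ℕ), F.Nonempty ∧ (∀ t ∈ F, x t ∈ X t) ∧ z = ∑ t ∈ F, x t}

/-- A sequence of sets whose finite sums have widely separated binary blocks: elements of `X n` are
divisible by powers of two exceeding four times the sums `M n` of the preceding terms. -/
structure IsSparse (X : ℕ → Set ℕ) (M K : ℕ → ℕ) : Prop where
  pos : ∀ n, ∀ x ∈ X n, 0 < x
  dvd : ∀ n t, n ≤ t → ∀ x ∈ X t, 2 ^ K n ∣ x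
  le_M : ∀ n, n ≤ M n
  add_le_M : ∀ n, ∀ x ∈ X n, M n + x ≤ M (n + 1)
  four_mul_lt : ∀ n, 4 * M n < 2 ^ K n
  mono : Monotone K
  two_mul_notMem : ∀ n, ∀ x ∈ X n, 2 * x ∉ X n

namespace IsSparse

variable {X : ℕ → Set ℕ} {M K : ℕ → ℕ}

theorem mono_M (h : IsSparse X M K) (hne : ∀ n, (X n).Nonempty) : Monotone M :=
  monotone_nat_of_le_succ fun n => by
    obtain ⟨x, hx⟩ := hne n
    have := h.add_le_M n x hx
    omega

theorem sum_le (h : IsSparse X M K) (hne : ∀ n, (X n).Nonempty) {x : ℕ → ℕ} (n : ℕ) :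
    ∀ {F : Finset ℕ}, (∀ t ∈ F, t < n) → (∀ t ∈ F, x t ∈ X t) → ∑ t ∈ F, x t ≤ M n := by
  induction n with
  | zero =>
    intro F hF _
    rw [Finset.eq_empty_of_forall_notMem fun t ht => Nat.not_lt_zero _ (hF t ht)]
    simp
  | succ n ih =>
    intro F hF hx
    have hlt : ∀ t ∈ F, t ≠ n → t < n := fun t ht hn =>
      lt_of_le_of_ne (Nat.lt_succ_iff.1 (hF t ht)) hn
    by_cases hn : n ∈ F
    · rw [← Finset.sum_erase_add _ _ hn]
      have := ih (F := F.erase n)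
        (fun t ht => hlt t (Finset.mem_of_mem_erase ht) (Finset.ne_of_mem_erase ht))
        (fun t ht => hx t (Finset.mem_of_mem_erase ht))
      have := h.add_le_M n _ (hx n hn)
      omega
    · exact (ih (fun t ht => hlt t ht fun h => hn (h ▸ ht)) hx).trans
        (h.mono_M hne n.le_succ)

theorem dvd_sum (h : IsSparse X M K) {x : ℕ → ℕ} {n : ℕ} {F : Finset ℕ} (hF : ∀ t ∈ F, n ≤ t)
    (hx : ∀ t ∈ F, x t ∈ X t) : 2 ^ K n ∣ ∑ t ∈ F, x t :=
  Finset.dvd_sum fun t ht => h.dvd n t (hF t ht) _ (hx t ht)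

/-- The binary blocks of a finite sum before, at and after position `n`. -/
theorem exists_split (h : IsSparse X M K) (hne : ∀ n, (X n).Nonempty) {x : ℕ → ℕ}
    {F : Finset ℕ} (hx : ∀ t ∈ F, x t ∈ X t) (n : ℕ) :
    ∃ s e c, s ≤ M n ∧ (e = 0 ∨ e ∈ X n) ∧ ∑ t ∈ F, x t = s + e + 2 ^ K (n + 1) * c := by
  obtain ⟨c, hc⟩ := h.dvd_sum (n := n + 1) (F := F.filter (n + 1 ≤ ·))
    (fun t ht => (Finset.mem_filter.1 ht).2) (fun t ht => hx t (Finset.mem_filter.1 ht).1)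
  refine ⟨∑ t ∈ F.filter (· < n), x t, ∑ t ∈ F.filter (· = n), x t, c,
    h.sum_le hne n (fun t ht => (Finset.mem_filter.1 ht).2)
      (fun t ht => hx t (Finset.mem_filter.1 ht).1), ?_, ?_⟩
  · rw [Finset.filter_eq']
    split_ifs with hn
    · right
      rw [Finset.sum_singleton]
      exact hx n hn
    · left
      rfl
  · rw [← hc, Finset.sum_filter, Finset.sum_filter, Finset.sum_filter, ← Finset.sum_add_distrib,
      ← Finset.sum_add_distrib]
    refine Finset.sum_congr rfl fun t _ => ?_
    rcases lt_trichotomy t n with ht | ht | ht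
    · rw [if_pos ht, if_neg ht.ne, if_neg (by omega)]; rfl
    · rw [if_neg (by omega), if_pos ht, if_neg (by omega), zero_add, add_zero]
    · rw [if_neg (by omega), if_neg ht.ne', if_pos (Nat.succ_le_of_lt ht), zero_add, zero_add]

/-- The finite sums of a sparse sequence do not contain a translated Milliken-Taylor system of
type `⟨2, 1⟩` together with its finite sums. -/
theorem not_contains_milliken_taylor (h : IsSparse X M K) (hne : ∀ n, (X n).Nonempty)
    (y : ℕ → ℕ) (b : ℕ) (hFS : ∀ F : Finset ℕ, F.Nonempty → ∑ t ∈ F, y t ∈ natFS X)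
    (hMT : ∀ F G : Finset ℕ, F.Nonempty → G.Nonempty → (∀ s ∈ F, ∀ t ∈ G, s < t) →
      b + 2 * ∑ t ∈ F, y t + ∑ t ∈ G, y t ∈ natFS X) : False := by
  -- This divisibility forces the first block `n` used by the sum to lie beyond `b`, whence `b < 2 ^
  -- K n` sits below that block.
  obtain ⟨F, hF, -, hFd⟩ := exists_dvd_sum y (2 ^ K (b + 1)) (by positivity) 0
  obtain ⟨F', x, hF', hx, hxe⟩ := hFS F hF
  have hn := F'.min'_mem hF'
  set n := F'.min' hF'
  have hxn := hx n hn
  have hxpos := h.pos n _ hxn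
  obtain ⟨c, hc⟩ := h.dvd_sum (n := n + 1) (F := F'.erase n) (x := x)
    (fun t ht => lt_of_le_of_ne (F'.min'_le t (Finset.mem_of_mem_erase ht))
      (Finset.ne_of_mem_erase ht).symm)
    (fun t ht => hx t (Finset.mem_of_mem_erase ht))
  rw [← Finset.add_sum_erase _ _ hn, hc] at hxe
  have hM1 := h.add_le_M n _ hxn
  have hK1 := h.four_mul_lt (n + 1)
  have hK0 := h.four_mul_lt n
  have hbn : b + 1 ≤ n := by
    by_contra hlt
    have h1 : 2 ^ K (n + 1) ∣ x n + 2 ^ K (n + 1) * c := by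
      rw [← hxe]
      exact (pow_dvd_pow 2 (h.mono (by omega))).trans hFd
    have h2 := Nat.le_of_dvd hxpos ((Nat.dvd_add_left (Dvd.intro _ rfl)).1 h1)
    omega
  have hbK : b < 2 ^ K n := by
    have := h.le_M n
    omega
  have hxK : 2 ^ K n ∣ x n := h.dvd n n le_rfl _ hxn
  have hxK' := Nat.le_of_dvd hxpos hxK
  -- The second sum vanishes mod `2 ^ K (n + 1)`, so it does not disturb block `n`.
  obtain ⟨G, hG, hGF, w, hw⟩ := exists_dvd_sum y (2 ^ K (n + 1)) (by positivity) (F.max' hF + 1)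
  obtain ⟨F'', x'', -, hx'', hxe''⟩ := hMT F G hF hG fun s hs t ht =>
    Nat.lt_of_lt_of_le (Nat.lt_succ_of_le (F.le_max' s hs)) (hGF t ht)
  obtain ⟨s, e, c'', hs, he, hse⟩ := h.exists_split hne hx'' n
  rw [hse, hxe, hw] at hxe''
  have heK : 2 ^ K n ∣ e := by
    rcases he with rfl | he
    · exact dvd_zero _
    · exact h.dvd n n le_rfl _ he
  have heM : s + e ≤ M (n + 1) := by
    rcases he with rfl | he
    · omega
    · have := h.add_le_M n _ he
      omega
  -- Both sides are below `2 ^ K (n + 1)`, so congruence is equality; the factor in `four_mul_lt`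
  -- leaves room for the doubling. Reducing mod `2 ^ K n` next separates `b = s` from `2 * x n = e`.
  have h1 : b + 2 * x n = s + e := by
    refine Nat.ModEq.eq_of_lt_of_lt (m := 2 ^ K (n + 1)) ?_ (by omega) (by omega)
    have h2 : (b + 2 * x n) + 2 ^ K (n + 1) * (2 * c + w) = (s + e) + 2 ^ K (n + 1) * c'' := by
      rw [← hxe'']
      ring
    have h3 : ((b + 2 * x n) + 2 ^ K (n + 1) * (2 * c + w)) % 2 ^ K (n + 1) =
        ((s + e) + 2 ^ K (n + 1) * c'') % 2 ^ K (n + 1) := by rw [h2]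
    rwa [Nat.add_mul_mod_self_left, Nat.add_mul_mod_self_left] at h3
  have h4 : b = s := by
    refine Nat.ModEq.eq_of_lt_of_lt (m := 2 ^ K n) ?_ hbK (by omega)
    obtain ⟨u, hu⟩ := hxK
    obtain ⟨u', hu'⟩ := heK
    rw [hu, hu'] at h1
    have h3 : (b + 2 ^ K n * (2 * u)) % 2 ^ K n = (s + 2 ^ K n * u') % 2 ^ K n := by
      rw [← h1]
      congr 1
      ring
    rwa [Nat.add_mul_mod_self_left, Nat.add_mul_mod_self_left] at h3
  rcases he with rfl | he
  · omega
  · have : e = 2 * x n := by omega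
    rw [this] at he
    exact h.two_mul_notMem n _ hxn he

end IsSparse

/-- Every ultrafilter has a member containing no number together with its double. -/
theorem exists_mem_two_mul_notMem (p : Ultrafilter ℕ+) :
    ∃ A ∈ p, ∀ x ∈ A, ∀ y ∈ A, (y : ℕ) ≠ 2 * x := by
  have hpar : ∀ x y : ℕ+, (y : ℕ) = 2 * x →
      padicValNat 2 y = padicValNat 2 x + 1 := by
    intro x y h
    rw [h, padicValNat.mul (by norm_num) x.pos.ne', padicValNat.self (by norm_num), add_comm]
  -- Doubling flips the parity of the 2-adic valuation.
  rcases p.mem_or_compl_mem {x | Even (padicValNat 2 (x : ℕ))} with h | h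
  · refine ⟨_, h, fun x hx y hy hxy => ?_⟩
    change Even _ at hx
    change Even _ at hy
    rw [hpar x y hxy, Nat.even_add_one] at hy
    exact hy hx
  · refine ⟨_, h, fun x hx y hy hxy => ?_⟩
    change ¬ Even _ at hx
    change ¬ Even _ at hy
    rw [hpar x y hxy, Nat.even_add_one, not_not] at hy
    exact hx hy

theorem exists_isSparse (B : ℕ → FiniteIPRMatrix) :
    ∃ (x : (n : ℕ) → Fin (B n).v → ℕ+) (X : ℕ → Set ℕ) (M K : ℕ → ℕ), IsSparse X M K ∧
      (∀ n, (X n).Nonempty) ∧ ∀ n i, ∃ a ∈ X n, apply (B n).mat (x n) i = (a : ℚ) := by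
  obtain ⟨p, hp⟩ := exists_isMinimalIdempotent
  obtain ⟨A, hA, hA2⟩ := exists_mem_two_mul_notMem p
  obtain ⟨Y, hY, -, hQ⟩ := exists_seq_of_idempotent hp.1
    (fun n => {Y | (∃ x : Fin (B n).v → ℕ+, toRat (Y : Set ℕ+) = image (B n).mat x) ∧
      (Y : Set ℕ+) ⊆ A})
    (fun n R hR => by
      obtain ⟨x, hx⟩ := (B n).isIPR.exists_image_subset_of_mem hp (inter_mem hR hA)
      obtain ⟨Y, hY, hYR⟩ := exists_finset_toRat_eq_image hx
      exact ⟨Y, ⟨⟨x, hY⟩, hYR.trans Set.inter_subset_right⟩, hYR.trans Set.inter_subset_left⟩)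
    -- Here `Q` encodes sparseness: later sums are divisible by a power of two exceeding `4 * a`.
    (univ_mem : Set.univ ∈ p) (fun a => {y | 2 ^ Nat.size (4 * a) ∣ (y : ℕ)})
    (fun a _ => dvd_mem_of_idempotent hp.1 _ (by positivity))
  choose x hx using fun n => (hY n).1
  have hYA := fun n => (hY n).2
  have hmem : ∀ n i, ∃ a ∈ Y n, apply (B n).mat (x n) i = ((a : ℕ) : ℚ) := by
    intro n i
    have : apply (B n).mat (x n) i ∈ toRat (Y n : Set ℕ+) := by
      rw [hx n]
      exact ⟨i, rfl⟩
    obtain ⟨a, ha, hae⟩ := this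
    exact ⟨a, ha, hae.symm⟩
  have hne : ∀ n, (Y n).Nonempty := fun n => by
    obtain ⟨a, ha, -⟩ := hmem n ⟨0, (B n).u_pos⟩
    exact ⟨a, ha⟩
  let μ : ℕ → ℕ+ := fun n => (Y n).max' (hne n)
  have hμ : ∀ n, μ n ∈ Y n := fun n => (Y n).max'_mem (hne n)
  let M : ℕ → ℕ := fun n => ∑ t ∈ Finset.range n, (μ t : ℕ)
  have hM : ∀ n, M (n + 1) = M n + μ n := fun n => Finset.sum_range_succ _ _
  refine ⟨x, fun n => (fun a : ℕ+ => (a : ℕ)) '' (Y n : Set ℕ+), M, fun n => Nat.size (4 * M n),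
    ⟨?_, ?_, ?_, ?_, ?_, ?_, ?_⟩, fun n => (hne n).to_set.image _, fun n i => ?_⟩
  · rintro n _ ⟨a, -, rfl⟩
    exact a.pos
  · rintro n t hnt _ ⟨a, ha, rfl⟩
    rcases Nat.eq_zero_or_pos n with rfl | hn
    · simp [M]
    -- The earlier sum is the sum of the maxima, namely `M n`, and the later one is the single term
    -- `a`. For `n = 0` the earlier sum would be empty, but there the modulus is `1`.
    obtain ⟨a', b, ha', hb, hab⟩ := hQ (Finset.range n) {t} (fun s => if s = t then a else μ s)
      ⟨0, Finset.mem_range.2 hn⟩ ⟨t, Finset.mem_singleton_self t⟩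
      (fun s hs s' hs' => by
        rw [Finset.mem_singleton] at hs'
        rw [Finset.mem_range] at hs
        omega)
      (fun s hs => by
        rw [if_neg (by rw [Finset.mem_range] at hs; omega)]
        exact hμ s)
      (fun s hs => by
        rw [Finset.mem_singleton] at hs
        subst hs
        rw [if_pos rfl]
        exact ha)
    have h1 : (a' : ℕ) = M n := by
      rw [ha']
      refine Finset.sum_congr rfl fun s hs => ?_
      rw [if_neg (by rw [Finset.mem_range] at hs; omega)]
    have h2 : (b : ℕ) = a := by simpa using hb
    change 2 ^ Nat.size (4 * (a' : ℕ)) ∣ (b : ℕ) at hab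
    rwa [h1, h2] at hab
  · intro n
    induction n with
    | zero => exact Nat.zero_le _
    | succ n ih =>
      rw [hM]
      have := (μ n).pos
      omega
  · rintro n _ ⟨a, ha, rfl⟩
    rw [hM]
    have : (a : ℕ) ≤ μ n := PNat.coe_le_coe _ _ |>.2 ((Y n).le_max' a ha)
    dsimp only
    omega
  · intro n
    exact Nat.lt_size_self _
  · refine monotone_nat_of_le_succ fun n => Nat.size_le_size ?_
    rw [hM]
    omega
  · rintro n _ ⟨a, ha, rfl⟩ ⟨a', ha', h⟩
    exact hA2 a (hYA n ha) a' (hYA n ha') h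
  · obtain ⟨a, ha, hae⟩ := hmem n i
    exact ⟨a, ⟨a, ha, rfl⟩, hae⟩

/-- A dominated image inside the sparse one would give, from the first row of each block, a sequence
whose finite sums and translated Milliken-Taylor sums all lie in `natFS X`, against
`IsSparse.not_contains_milliken_taylor`. -/
theorem not_imageDominates_extend {B : ℕ → FiniteIPRMatrix} {D : Matrix ℕ ℕ ℚ}
    (hD : IsDHMatrix B D) : ¬ ImageDominates D (extend B D) := by
  intro hdom
  obtain ⟨x, X, M, K, hX, hne, hxX⟩ := exists_isSparse B
  obtain ⟨x', hx'⟩ := exists_concatenation B x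
  obtain ⟨y, hy⟩ := hdom x'
  have himage : ∀ q ∈ image D x', ∃ a ∈ natFS X, q = (a : ℚ) := by
    rintro _ ⟨k, rfl⟩
    obtain ⟨F, i, hF, hr⟩ := hD.exists_isDHRow k
    choose a ha hae using fun n => hxX n (i n)
    refine ⟨_, ⟨F, a, hF, fun t _ => ha t, rfl⟩, (hr.finsum_mul x').trans ?_⟩
    push_cast
    refine Finset.sum_congr rfl fun n _ => ?_
    rw [← hae, show (fun t : Fin (B n).v => x' (blockStart B n + t)) = x n from
      funext fun t => hx' n t]
  let i₀ : (n : ℕ) → Fin (B n).u := fun n => ⟨0, (B n).u_pos⟩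
  let z : ℕ → ℚ := fun n =>
    apply (B n).mat (fun t => y (some (blockStart B n + t))) (i₀ n)
  have hrow : ∀ {F k}, IsDHRow B F i₀ (D k) → apply D (fun m => y (some m)) k = ∑ t ∈ F, z t :=
    fun hr => hr.finsum_mul _
  have hFS : ∀ F : Finset ℕ, F.Nonempty → ∃ a ∈ natFS X, ∑ t ∈ F, z t = (a : ℚ) := by
    intro F hF
    obtain ⟨k, hk⟩ := hD.exists_index hF i₀
    apply himage
    apply hy
    exact ⟨.inl k, by rw [apply_extend_inl B hD.rowFinite, hrow hk]⟩
  have hz : ∀ t, ∃ a : ℕ, z t = (a : ℚ) := by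
    intro t
    obtain ⟨a, -, ha⟩ := hFS {t} (Finset.singleton_nonempty t)
    exact ⟨a, by simpa using ha⟩
  choose c hc using hz
  have hsum : ∀ F : Finset ℕ, ∑ t ∈ F, z t = ((∑ t ∈ F, c t : ℕ) : ℚ) := by
    intro F
    push_cast
    exact Finset.sum_congr rfl fun t _ => hc t
  refine hX.not_contains_milliken_taylor hne c (y none) (fun F hF => ?_)
    (fun F G hF hG hFG => ?_)
  · obtain ⟨a, ha, hae⟩ := hFS F hF
    rw [hsum] at hae
    rwa [Nat.cast_injective hae]
  · obtain ⟨k, hk⟩ := hD.exists_index hF i₀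
    obtain ⟨l, hl⟩ := hD.exists_index hG i₀
    have hval := apply_extend_inr B hD.rowFinite y
      ⟨(k, l), F, G, i₀, i₀, hF, hG, hFG, hk, hl⟩
    obtain ⟨a, ha, hae⟩ := himage _ (hy ⟨_, rfl⟩)
    replace hae := hval.symm.trans hae
    dsimp only at hae
    rw [hrow hk, hrow hl, hsum, hsum] at hae
    have : (y none : ℕ) + 2 * ∑ t ∈ F, c t + ∑ t ∈ G, c t = a := by
      rw [add_assoc]
      exact_mod_cast hae
    rwa [this]

theorem IsDHMatrix.isIPR {B : ℕ → FiniteIPRMatrix} {D : Matrix ℕ ℕ ℚ} (hD : IsDHMatrix B D) :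
    IsIPR D :=
  (isIPR_extend hD).of_imageDominates (imageDominates_extend hD.rowFinite) hD.rowFinite

theorem IsDHMatrix.not_universallyImageMaximal {B : ℕ → FiniteIPRMatrix} {D : Matrix ℕ ℕ ℚ}
    (hD : IsDHMatrix B D) : ¬ UniversallyImageMaximal D := by
  rintro ⟨-, h⟩
  have : Countable (SeparatedRows B D) := Subtype.countable
  exact not_imageDominates_extend hD
    (h _ _ (extend B D) (isIPR_extend hD) (imageDominates_extend hD.rowFinite))

end DH

theorem theorem6p6 (B : ℕ → DH.FiniteIPRMatrix) (hB : Function.Surjective B) :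
    (∀ p : Ultrafilter ℕ+, DH.IsMinimalIdempotent p → ∀ A ∈ p,
      ∃ (b : ℕ+) (Y : ℕ → Finset ℕ+),
        (∀ n, ∃ x : Fin (B n).v → ℕ+, DH.toRat (Y n : Set ℕ+) = DH.image (B n).mat x) ∧
        DH.FS (fun n => DH.toRat (Y n : Set ℕ+)) ∪
            (((b : ℕ) : ℚ) +ᵥ DH.MT ![2, 1] (fun n => DH.toRat (Y n : Set ℕ+))) ⊆
          DH.toRat A) ∧
    (∀ D : Matrix ℕ ℕ ℚ, DH.IsDHMatrix B D →
      DH.IsIPR D ∧ ¬ DH.UniversallyImageMaximal D) :=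
  ⟨fun _ hp _ hA => DH.exists_FS_union_MT_subset B hp hA,
    fun _ hD => ⟨hD.isIPR, hD.not_universallyImageMaximal⟩⟩
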